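/- \textbf{Theorem.} Let $\alpha$ be a rational number with $0\le\alpha<1$. For each of the three kinds of votes (top orders, bottom orders, weak orders) and each of the two domain restrictions (single-peaked, single-plateaued), the following decision problem, Copeland$^\alpha$-CWCM, is in $\mathrm{P}$ (weights are written in binary). \emph{Input:} a finite candidate set $C$; a total order $L$ of $C$ (the axis); a list of nonmanipulators, each with a positive integer weight and a vote on $C$ of the given kind satisfying the given restriction with respect to $L$; a list of manipulators, each with a positive integer weight; and a candidate $p\in C$. \emph{Question:} can each manipulator be given a vote on $C$ of the given kind satisfying the given restriction with respect to $L$, so that $p$ is a (not necessarily unique) Copeland$^\alpha$ winner of the weighted election consisting of all nonmanipulators and manipulators? Here a weak order is a complete, reflexive, transitive relation, written $G_1>G_2>\dots>G_r$ with nonempty groups $G_i$ of tied candidates. It is a top order if every group except possibly $G_r$ is a singleton, and a bottom order if every group except possibly $G_1$ is a singleton. A vote $v$ is \emph{single-plateaued} with respect to $L$ if $L$ splits into consecutive segments $X$, $Y$, $Z$ ($X$ and $Z$ possibly empty) such that $Y$ is the set of most preferred candidates of $v$, $v$ is strictly increasing along $X$ (each candidate is strictly preferred to those on its left) and strictly decreasing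 along $Z$; it is \emph{single-peaked} if moreover $Y$ consists of a single candidate. In a Copeland$^\alpha$ election a candidate $a$ receives, for each other candidate $b$, one point if the total weight of the voters who strictly prefer $a$ to $b$ exceeds the total weight of those who strictly prefer $b$ to $a$, and $\alpha$ points if these two weights are equal; the winners are the candidates with the highest score. -/

import Mathlib

/-! ### Votes with ties -/

namespace TiedVoting

/-- Candidates are named by natural numbers. A vote with ties `G₁ > G₂ > ⋯ > G_r` is the list
`[G₁, …, G_r]` of its groups of tied candidates, from most to least preferred. -/
abbrev Vote : Type := List (List ℕ)

/-- `v` is a weak order on the candidates listed (without repetition) in `C`: its groups are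
nonempty and they partition `C`. -/
def IsWeakOrder (C : List ℕ) (v : Vote) : Prop :=
  (∀ G ∈ v, G ≠ []) ∧ v.flatten.Perm C

/-- The index of the group of `v` that contains `a`. -/
def position (v : Vote) (a : ℕ) : ℕ := v.findIdx (fun G => decide (a ∈ G))

/-- `v` strictly prefers `a` to `b`. -/
def Prefers (v : Vote) (a b : ℕ) : Prop := position v a < position v b

instance (v : Vote) (a b : ℕ) : Decidable (Prefers v a b) :=
  inferInstanceAs (Decidable (position v a < position v b))

/-- The kinds of votes with ties. -/
inductive OrderKind
  | top
  | bottom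
  | weak

/-- In a top order only the bottom-ranked candidates may be tied with one another, in a bottom
order only the top-ranked ones; a weak order is not restricted. -/
def OrderKind.Allows : OrderKind → Vote → Prop
  | .top, v => ∀ G ∈ v.dropLast, G.length = 1
  | .bottom, v => ∀ G ∈ v.tail, G.length = 1
  | .weak, _ => True

/-! ### Single-peaked and single-plateaued votes

An axis `L` is the list of all candidates, from left to right. -/

/-- No candidate on `L` is strictly preferred to `a`. -/
def MostPreferred (L : List ℕ) (v : Vote) (a : ℕ) : Prop := ∀ b ∈ L, ¬ Prefers v b a

/-- Each candidate of the segment is strictly preferred to all candidates on its left. -/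
def StrictlyIncreasing (v : Vote) (X : List ℕ) : Prop := X.Pairwise (fun a b => Prefers v b a)

/-- Each candidate of the segment is strictly preferred to all candidates on its right. -/
def StrictlyDecreasing (v : Vote) (Z : List ℕ) : Prop := Z.Pairwise (fun a b => Prefers v a b)

/-- The axis splits into segments `X`, `Y`, `Z` such that `Y` consists of the most preferred
candidates, and `v` is strictly increasing along `X` and strictly decreasing along `Z`. -/
def SinglePlateaued (L : List ℕ) (v : Vote) : Prop :=
  ∃ X Y Z : List ℕ, L = X ++ Y ++ Z ∧ (∀ a ∈ L, a ∈ Y ↔ MostPreferred L v a) ∧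
    StrictlyIncreasing v X ∧ StrictlyDecreasing v Z

/-- As above, with a unique most preferred candidate. -/
def SinglePeaked (L : List ℕ) (v : Vote) : Prop :=
  ∃ (X : List ℕ) (y : ℕ) (Z : List ℕ), L = X ++ [y] ++ Z ∧
    (∀ a ∈ L, a = y ↔ MostPreferred L v a) ∧
    StrictlyIncreasing v X ∧ StrictlyDecreasing v Z

/-- The two domain restrictions. -/
inductive Shape
  | singlePeaked
  | singlePlateaued

def Shape.Allows : Shape → List ℕ → Vote → Prop
  | .singlePeaked, L, v => SinglePeaked L v
  | .singlePlateaued, L, v => SinglePlateaued L v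

/-- The votes that may be cast, for a kind of order, a domain restriction and an axis. -/
def Admissible (k : OrderKind) (s : Shape) (L : List ℕ) (v : Vote) : Prop :=
  IsWeakOrder L v ∧ k.Allows v ∧ s.Allows L v

/-! ### Weighted Copeland elections -/

/-- A weighted profile: each voter has a weight and a vote. -/
abbrev Profile : Type := List (ℕ × Vote)

/-- The total weight of the voters who strictly prefer `a` to `b`. -/
def support (V : Profile) (a b : ℕ) : ℕ :=
  (V.map (fun x => if Prefers x.2 a b then x.1 else 0)).sum

/-- The Copeland score with parameter `α`: one point for each pairwise majority election won and
`α` points for each one that ends in a tie. -/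
def copelandScore (α : ℚ) (C : Finset ℕ) (V : Profile) (a : ℕ) : ℚ :=
  (((C.erase a).filter (fun b => support V b a < support V a b)).card : ℚ) +
    α * (((C.erase a).filter (fun b => support V a b = support V b a)).card : ℚ)

/-- `p` is a (not necessarily unique) Copeland winner. -/
def IsCopelandWinner (α : ℚ) (C : Finset ℕ) (V : Profile) (p : ℕ) : Prop :=
  p ∈ C ∧ ∀ c ∈ C, copelandScore α C V c ≤ copelandScore α C V p

/-! ### Constructive weighted coalitional manipulation -/

/-- The data of an input: the axis (which also lists the candidates), the weighted votes of the
nonmanipulators, the weights of the manipulators, and the preferred candidate. -/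
structure CWCMInstance where
  axis : List ℕ
  nonmanipulators : Profile
  manipulators : List ℕ
  preferred : ℕ

/-- The data form an instance of the manipulation problem for the given kind of orders and the
given domain restriction. -/
def CWCMInstance.Valid (I : CWCMInstance) (k : OrderKind) (s : Shape) : Prop :=
  I.axis.Nodup ∧ I.preferred ∈ I.axis ∧
    (∀ x ∈ I.nonmanipulators, 0 < x.1 ∧ Admissible k s I.axis x.2) ∧
    (∀ w ∈ I.manipulators, 0 < w)

/-- The manipulators can cast admissible votes (the `i`-th vote is cast by the `i`-th manipulator)
such that the preferred candidate is a winner. -/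
def CWCMInstance.Manipulable (I : CWCMInstance) (α : ℚ) (k : OrderKind) (s : Shape) : Prop :=
  ∃ votes : List Vote, votes.length = I.manipulators.length ∧
    (∀ v ∈ votes, Admissible k s I.axis v) ∧
    IsCopelandWinner α I.axis.toFinset (I.nonmanipulators ++ I.manipulators.zip votes) I.preferred

/-! ### Encoding of instances as words, with all numbers in binary -/

/-- A finite alphabet with two bits, brackets and a comma. -/
abbrev Symbol : Type := Computability.Γ'

/-- A natural number: its binary digits, terminated by a comma. -/
def encodeNumber (n : ℕ) : List Symbol :=
  (Computability.encodeNat n).map Computability.Γ'.bit ++ [Computability.Γ'.comma]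

/-- A list: the codes of its entries between brackets. -/
def encodeSeq {β : Type} (e : β → List Symbol) (l : List β) : List Symbol :=
  Computability.Γ'.bra :: (l.flatMap e ++ [Computability.Γ'.ket])

def encodeVote (v : Vote) : List Symbol := encodeSeq (encodeSeq encodeNumber) v

def encodeVoter (x : ℕ × Vote) : List Symbol := encodeNumber x.1 ++ encodeVote x.2

def CWCMInstance.encode (I : CWCMInstance) : List Symbol :=
  encodeSeq encodeNumber I.axis ++ (encodeSeq encodeVoter I.nonmanipulators ++
    (encodeSeq encodeNumber I.manipulators ++ encodeNumber I.preferred))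

/-- The decision problem Copeland-`α`-CWCM for the given kind of orders and the given domain
restriction, as a formal language. -/
def copelandCWCM (α : ℚ) (k : OrderKind) (s : Shape) : Set (List Symbol) :=
  {w | ∃ I : CWCMInstance, I.encode = w ∧ I.Valid k s ∧ I.Manipulable α k s}

open Classical in
/-- The class P: languages whose characteristic function is computed in polynomial time by a
(multi-stack) Turing machine. -/
def InP {Γ : Type} (A : Set (List Γ)) : Prop :=
  Nonempty (Turing.TM2ComputableInPolyTime (id : List Γ → List Γ) Computability.encodeBool
    (fun w => decide (w ∈ A)))

/-! ### The encoding of instances is injective -/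

/-- Codewords can be split off unambiguously. -/
def PrefixCode {β : Type} (e : β → List Symbol) : Prop :=
  ∀ x y r t, e x ++ r = e y ++ t → x = y ∧ r = t

theorem prefixCode_encodeNumber : PrefixCode encodeNumber := by
  have key : ∀ (a b : List Bool) (r t : List Symbol),
      a.map Computability.Γ'.bit ++ ([Computability.Γ'.comma] ++ r) =
        b.map Computability.Γ'.bit ++ ([Computability.Γ'.comma] ++ t) → a = b ∧ r = t := by
    intro a
    induction a with
    | nil => intro b r t h; cases b <;> simp_all
    | cons x a ih =>
      intro b r t h
      cases b with
      | nil => simp at h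
      | cons y b =>
        simp only [List.map_cons, List.cons_append, List.cons.injEq,
          Computability.Γ'.bit.injEq] at h
        obtain ⟨h1, h2⟩ := ih b r t h.2
        exact ⟨by rw [h.1, h1], h2⟩
  intro x y r t h
  simp only [encodeNumber, List.append_assoc] at h
  obtain ⟨h1, h2⟩ := key _ _ _ _ h
  refine ⟨?_, h2⟩
  have := congrArg Computability.decodeNat h1
  simpa using this

theorem prefixCode_encodeSeq {β : Type} {e : β → List Symbol} (he : PrefixCode e)
    (hk : ∀ x r t, e x ++ r ≠ Computability.Γ'.ket :: t) : PrefixCode (encodeSeq e) := by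
  intro a
  induction a with
  | nil =>
    intro b r t h
    cases b with
    | nil => simpa [encodeSeq] using h
    | cons y b =>
      simp only [encodeSeq, List.flatMap_nil, List.flatMap_cons, List.cons_append,
        List.cons.injEq, true_and, List.append_assoc, List.nil_append] at h
      exact absurd h.symm (hk _ _ _)
  | cons x a ih =>
    intro b r t h
    cases b with
    | nil =>
      simp only [encodeSeq, List.flatMap_nil, List.flatMap_cons, List.cons_append,
        List.cons.injEq, true_and, List.append_assoc, List.nil_append] at h
      exact absurd h (hk _ _ _)
    | cons y b =>
      simp only [encodeSeq, List.flatMap_cons, List.cons_append,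
        List.cons.injEq, true_and, List.append_assoc] at h
      obtain ⟨rfl, h⟩ := he _ _ _ _ h
      obtain ⟨rfl, rfl⟩ := ih b r t (by simpa [encodeSeq] using h)
      exact ⟨rfl, rfl⟩

theorem encodeNumber_ne_ket (n : ℕ) (r t : List Symbol) :
    encodeNumber n ++ r ≠ Computability.Γ'.ket :: t := by
  unfold encodeNumber
  cases Computability.encodeNat n <;> simp

theorem encodeSeq_ne_ket {β : Type} (e : β → List Symbol) (l : List β) (r t : List Symbol) :
    encodeSeq e l ++ r ≠ Computability.Γ'.ket :: t := by
  simp [encodeSeq]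

theorem prefixCode_encodeVote : PrefixCode encodeVote :=
  prefixCode_encodeSeq (prefixCode_encodeSeq prefixCode_encodeNumber encodeNumber_ne_ket)
    (encodeSeq_ne_ket _)

theorem prefixCode_encodeVoter : PrefixCode encodeVoter := by
  rintro ⟨w, v⟩ ⟨w', v'⟩ r t h
  simp only [encodeVoter, List.append_assoc] at h
  obtain ⟨rfl, h₁⟩ := prefixCode_encodeNumber _ _ _ _ h
  obtain ⟨rfl, rfl⟩ := prefixCode_encodeVote _ _ _ _ h₁
  exact ⟨rfl, rfl⟩

theorem CWCMInstance.encode_injective : Function.Injective CWCMInstance.encode := by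
  rintro ⟨a, S, T, p⟩ ⟨a', S', T', p'⟩ h
  have hn := prefixCode_encodeSeq prefixCode_encodeNumber encodeNumber_ne_ket
  have hv : PrefixCode (encodeSeq encodeVoter) :=
    prefixCode_encodeSeq prefixCode_encodeVoter fun x r t => by
      simp only [encodeVoter, List.append_assoc]
      exact encodeNumber_ne_ket _ _ _
  simp only [CWCMInstance.encode] at h
  obtain ⟨rfl, h₁⟩ := hn _ _ _ _ h
  obtain ⟨rfl, h₂⟩ := hv _ _ _ _ h₁
  obtain ⟨rfl, h₃⟩ := hn _ _ _ _ h₂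
  obtain ⟨rfl, -⟩ := prefixCode_encodeNumber p p' [] [] (by simpa using h₃)
  rfl

end TiedVoting

/-!
If `y` lies between `x` and `z` on the axis, a single-plateaued voter who strictly prefers `x` to
`y` also strictly prefers `y` to `z`. Hence if `a` beats `p` in a pairwise election, then `a` has a
higher Copeland score than `p`, so Copeland winners are weak Condorcet winners. It follows that if
`p` can be made a winner, then `p` wins when all manipulators cast the same vote, which ranks `p`
first, followed by all candidates on one side of `p`, and then by all those on the other side, each
by distance from `p`. So it suffices to test two ballots.

For membership in P, data are represented by binary trees. The functions on such data that stack
programs compute in polynomial time are closed under composition, case distinction and folds whose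
accumulator stays small, which covers the parsing of the input and all tests. The stack programs
compile to Turing machines that take one step per instruction.
-/

/-! ### Margins and scores -/

namespace TiedVoting

section Margin

/-- The preference of `v` between `a` and `b` as a number: `1` if `a` is strictly preferred, `-1` if
`b` is, and `0` if they are tied. -/
def prefSign (v : Vote) (a b : ℕ) : ℤ :=
  if Prefers v a b then 1 else if Prefers v b a then -1 else 0

theorem prefSign_self (v : Vote) (a : ℕ) : prefSign v a a = 0 := by simp [prefSign, Prefers]

theorem prefSign_le_one (v : Vote) (a b : ℕ) : prefSign v a b ≤ 1 := by
  unfold prefSign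
  split_ifs <;> omega

theorem neg_one_le_prefSign (v : Vote) (a b : ℕ) : -1 ≤ prefSign v a b := by
  unfold prefSign
  split_ifs <;> omega

theorem prefSign_eq_one {v : Vote} {a b : ℕ} : prefSign v a b = 1 ↔ Prefers v a b := by
  unfold prefSign
  split_ifs <;> simp_all

theorem prefSign_eq_neg_one {v : Vote} {a b : ℕ} : prefSign v a b = -1 ↔ Prefers v b a := by
  unfold prefSign Prefers
  split_ifs <;> omega

/-- The margin of the pairwise majority election between `a` and `b`: the total weight of the voters
who strictly prefer `a` minus that of the voters who strictly prefer `b`. -/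
def margin (V : Profile) (a b : ℕ) : ℤ := (V.map fun x => (x.1 : ℤ) * prefSign x.2 a b).sum

theorem margin_cons (x : ℕ × Vote) (V : Profile) (a b : ℕ) :
    margin (x :: V) a b = x.1 * prefSign x.2 a b + margin V a b := by
  simp [margin]

theorem margin_append (V W : Profile) (a b : ℕ) :
    margin (V ++ W) a b = margin V a b + margin W a b := by
  simp [margin]

theorem margin_eq_sub (V : Profile) (a b : ℕ) :
    margin V a b = (support V a b : ℤ) - support V b a := by
  induction V with
  | nil => simp [margin, support]
  | cons x V ih =>
    simp only [support, List.map_cons, List.sum_cons] at ih ⊢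
    rw [margin_cons, ih, prefSign]
    split_ifs with hab hba
    · exact absurd hab (lt_asymm hba)
    all_goals push_cast; ring

theorem margin_swap (V : Profile) (a b : ℕ) : margin V b a = -margin V a b := by
  rw [margin_eq_sub, margin_eq_sub]
  ring

theorem margin_le_margin {V : Profile} {a b c d : ℕ}
    (h : ∀ x ∈ V, prefSign x.2 a b ≤ prefSign x.2 c d) : margin V a b ≤ margin V c d :=
  List.sum_le_sum fun x hx => mul_le_mul_of_nonneg_left (h x hx) (Int.natCast_nonneg _)

theorem margin_le_sum_mul {V : Profile} {a b : ℕ} {t : ℤ}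
    (h : ∀ x ∈ V, prefSign x.2 a b ≤ t) : margin V a b ≤ (V.map Prod.fst).sum * t := by
  induction V with
  | nil => simp [margin]
  | cons x V ih =>
    rw [List.forall_mem_cons] at h
    rw [margin_cons, List.map_cons, List.sum_cons, Nat.cast_add, add_mul]
    exact add_le_add (mul_le_mul_of_nonneg_left h.1 (Int.natCast_nonneg _)) (ih h.2)

theorem sum_mul_le_margin {V : Profile} {a b : ℕ} {t : ℤ}
    (h : ∀ x ∈ V, t ≤ prefSign x.2 a b) : (V.map Prod.fst).sum * t ≤ margin V a b := by
  induction V with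
  | nil => simp [margin]
  | cons x V ih =>
    rw [List.forall_mem_cons] at h
    rw [margin_cons, List.map_cons, List.sum_cons, Nat.cast_add, add_mul]
    exact add_le_add (mul_le_mul_of_nonneg_left h.1 (Int.natCast_nonneg _)) (ih h.2)

theorem forall_prefers_of_margin_eq_sum {V : Profile} {a b : ℕ} (hpos : ∀ x ∈ V, 0 < x.1)
    (h : margin V a b = (V.map Prod.fst).sum) : ∀ x ∈ V, Prefers x.2 a b := by
  induction V with
  | nil => simp
  | cons x V ih =>
    rw [List.forall_mem_cons] at hpos ⊢
    have hV : margin V a b ≤ (V.map Prod.fst).sum * 1 :=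
      margin_le_sum_mul fun y _ => prefSign_le_one y.2 a b
    have hx : (0 : ℤ) < x.1 := Int.natCast_pos.2 hpos.1
    have hsign := prefSign_le_one x.2 a b
    rw [margin_cons, List.map_cons, List.sum_cons, Nat.cast_add] at h
    have hone : prefSign x.2 a b = 1 := le_antisymm hsign (by nlinarith)
    exact ⟨prefSign_eq_one.1 hone, ih hpos.2 (by rw [hone] at h; omega)⟩

/-- The profile in which voters with the given weights all cast the vote `v`. -/
def unanimous (M : List ℕ) (v : Vote) : Profile := M.map fun w => (w, v)

theorem margin_unanimous (M : List ℕ) (v : Vote) (a b : ℕ) :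
    margin (unanimous M v) a b = M.sum * prefSign v a b := by
  induction M with
  | nil => simp [unanimous, margin]
  | cons w M ih =>
    rw [unanimous, List.map_cons, margin_cons, ← unanimous, ih, List.sum_cons, Nat.cast_add,
      add_mul]

end Margin

section Score

variable {α : ℚ} {m n : ℤ}

/-- The points that a candidate receives for a pairwise majority election with margin `m`. -/
def points (α : ℚ) (m : ℤ) : ℚ := if 0 < m then 1 else if m = 0 then α else 0

theorem points_of_pos (hm : 0 < m) : points α m = 1 := if_pos hm

theorem points_of_neg (hm : m < 0) : points α m = 0 := by
  rw [points, if_neg hm.not_gt, if_neg hm.ne]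

theorem points_mono (hα₀ : 0 ≤ α) (hα₁ : α ≤ 1) (h : m ≤ n) : points α m ≤ points α n := by
  unfold points
  split_ifs <;> first | omega | linarith

theorem points_le_one (hα₁ : α ≤ 1) (m : ℤ) : points α m ≤ 1 := by
  unfold points
  split_ifs <;> linarith

theorem points_nonneg (hα₀ : 0 ≤ α) (m : ℤ) : 0 ≤ points α m := by
  unfold points
  split_ifs <;> linarith

theorem copelandScore_eq_sum (α : ℚ) (C : Finset ℕ) (V : Profile) (a : ℕ) :
    copelandScore α C V a = ∑ b ∈ C.erase a, points α (margin V a b) := by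
  have hpoints (b : ℕ) : points α (margin V a b) =
      (if support V b a < support V a b then 1 else 0) +
        (if support V a b = support V b a then α else 0) := by
    rw [points, margin_eq_sub]
    split_ifs <;> first | omega | simp
  simp only [hpoints, Finset.sum_add_distrib, ← Finset.sum_filter, Finset.sum_const, nsmul_eq_mul,
    copelandScore, mul_one]
  ring

theorem copelandScore_le_of_margin_le (hα₀ : 0 ≤ α) (hα₁ : α ≤ 1) {C : Finset ℕ} {V W : Profile}
    {a : ℕ} (h : ∀ b ∈ C, margin V a b ≤ margin W a b) :
    copelandScore α C V a ≤ copelandScore α C W a := by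
  rw [copelandScore_eq_sum, copelandScore_eq_sum]
  exact Finset.sum_le_sum fun b hb => points_mono hα₀ hα₁ (h b (Finset.mem_of_mem_erase hb))

end Score

/-! ### Unimodal profiles -/

section Unimodal

/-- `v` has a single peak or plateau on `x`, `y`, `z`: once it decreases strictly in one direction
along these candidates, it goes on doing so. -/
def Unimodal (v : Vote) (x y z : ℕ) : Prop :=
  (Prefers v x y → Prefers v y z) ∧ (Prefers v z y → Prefers v y x)

variable {v : Vote} {V : Profile} {L : List ℕ} {x y z : ℕ}

theorem Unimodal.prefSign_le (h : Unimodal v x y z) : prefSign v x z ≤ prefSign v y z := by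
  unfold Unimodal Prefers at h
  unfold prefSign Prefers
  split_ifs <;> omega

theorem Unimodal.prefSign_add_le (h : Unimodal v x y z) :
    prefSign v x y + prefSign v z y ≤ 0 := by
  unfold Unimodal Prefers at h
  unfold prefSign Prefers
  split_ifs <;> omega

theorem Unimodal.of_prefers_left (h : Prefers v y x) : Unimodal v x y z :=
  ⟨fun hxy => absurd hxy (lt_asymm h), fun _ => h⟩

theorem Unimodal.of_prefers_right (h : Prefers v y z) : Unimodal v x y z :=
  ⟨fun _ => h, fun hzy => absurd hzy (lt_asymm h)⟩

theorem SinglePlateaued.triplewise_unimodal (h : SinglePlateaued L v) :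
    L.Triplewise (Unimodal v) := by
  obtain ⟨X, Y, Z, rfl, hY, hX, hZ⟩ := h
  rw [List.triplewise_iff_getElem]
  intro i j k hij hjk hk
  rcases lt_or_ge j X.length with hjX | hjX
  · refine .of_prefers_left ?_
    simpa [List.getElem_append, hjX, hij.trans hjX, Nat.lt_add_right] using
      List.pairwise_iff_getElem.1 hX i j (hij.trans hjX) hjX hij
  rcases lt_or_ge j (X ++ Y).length with hjY | hjY
  · have hmost : MostPreferred (X ++ Y ++ Z) v (X ++ Y ++ Z)[j] := by
      refine (hY _ (List.getElem_mem _)).1 ?_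
      rw [List.getElem_append_left hjY, List.getElem_append_right hjX]
      exact List.getElem_mem _
    exact ⟨fun h => absurd h (hmost _ (List.getElem_mem _)),
      fun h => absurd h (hmost _ (List.getElem_mem _))⟩
  · refine .of_prefers_right ?_
    rw [List.getElem_append_right hjY, List.getElem_append_right (hjY.trans hjk.le)]
    exact List.pairwise_iff_getElem.1 hZ _ _ _ _ (by omega)

/-- All votes in `V` are unimodal along the axis `L`. -/
def UnimodalOn (L : List ℕ) (V : Profile) : Prop :=
  L.Triplewise fun x y z => ∀ u ∈ V, Unimodal u.2 x y z

theorem unimodalOn_iff : UnimodalOn L V ↔ ∀ u ∈ V, L.Triplewise (Unimodal u.2) := by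
  simp only [UnimodalOn, List.triplewise_iff_getElem]
  exact ⟨fun h u hu i j k hij hjk hk => h i j k hij hjk hk u hu,
    fun h i j k hij hjk hk u hu => h u hu i j k hij hjk hk⟩

theorem UnimodalOn.reverse (h : UnimodalOn L V) : UnimodalOn L.reverse V :=
  List.triplewise_reverse.2 (h.imp fun hxyz u hu => And.symm (hxyz u hu))

theorem UnimodalOn.append {W : Profile} (hV : UnimodalOn L V) (hW : UnimodalOn L W) :
    UnimodalOn L (V ++ W) := by
  rw [unimodalOn_iff] at *
  exact fun u hu => (List.mem_append.1 hu).elim (hV u) (hW u)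

theorem margin_le_of_forall_unimodal (h : ∀ u ∈ V, Unimodal u.2 x y z) :
    margin V x z ≤ margin V y z :=
  margin_le_margin fun u hu => (h u hu).prefSign_le

theorem margin_add_margin_le_zero (h : ∀ u ∈ V, Unimodal u.2 x y z) :
    margin V x y + margin V z y ≤ 0 := by
  induction V with
  | nil => simp [margin]
  | cons u V ih =>
    rw [List.forall_mem_cons] at h
    have hu := mul_nonpos_of_nonneg_of_nonpos (Int.natCast_nonneg u.1) h.1.prefSign_add_le
    rw [margin_cons, margin_cons]
    linarith [ih h.2]

end Unimodal

end TiedVoting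

/-! ### Copeland winners of unimodal profiles -/

namespace TiedVoting

theorem triplewise_append_cons_append_cons {β : Type*} {T : β → β → β → Prop} {A B D : List β}
    {a b : β} (h : (A ++ a :: (B ++ b :: D)).Triplewise T) :
    (∀ x ∈ A, T x a b) ∧ (∀ x ∈ B, T a x b) ∧ ∀ x ∈ D, T a b x := by
  simp only [List.triplewise_append, List.triplewise_cons, List.pairwise_append,
    List.pairwise_cons, List.mem_append, List.mem_cons] at h
  exact ⟨fun x hx => (h.2.2.1 x hx).1 b (by simp), fun x hx => h.2.1.1.2.2 x hx b (by simp),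
    h.2.1.1.2.1.1⟩

section Winner

variable {α : ℚ} (hα₀ : 0 ≤ α) (hα₁ : α ≤ 1) {V : Profile} {a p : ℕ}
include hα₀ hα₁

theorem copelandScore_lt_of_margin_pos {A B D : List ℕ} (hL : (A ++ p :: (B ++ a :: D)).Nodup)
    (hV : UnimodalOn (A ++ p :: (B ++ a :: D)) V) (h : 0 < margin V a p) :
    copelandScore α (A ++ p :: (B ++ a :: D)).toFinset V p <
      copelandScore α (A ++ p :: (B ++ a :: D)).toFinset V a := by
  have hap : a ≠ p := by grind
  have hpa : margin V p a < 0 := by rw [margin_swap V a p]; omega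
  rw [copelandScore_eq_sum, copelandScore_eq_sum,
    ← Finset.add_sum_erase (Finset.erase _ p) (fun b => points α (margin V p b))
      (Finset.mem_erase.2 ⟨hap, by simp⟩),
    ← Finset.add_sum_erase (Finset.erase _ a) (fun b => points α (margin V a b))
      (Finset.mem_erase.2 ⟨hap.symm, by simp⟩),
    Finset.erase_right_comm, points_of_pos h, points_of_neg hpa]
  refine add_lt_add_of_lt_of_le one_pos (Finset.sum_le_sum fun x hx => ?_)
  obtain ⟨hleft, hbetween, hright⟩ := triplewise_append_cons_append_cons hV
  obtain hx | hx | hx : x ∈ A ∨ x ∈ B ∨ x ∈ D := by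
    simp only [Finset.mem_erase, List.mem_toFinset, List.mem_append, List.mem_cons] at hx
    tauto
  · have hxa : margin V x a ≤ margin V p a := margin_le_of_forall_unimodal (hleft x hx)
    rw [points_of_pos (m := margin V a x) (by rw [margin_swap V x a]; omega)]
    exact points_le_one hα₁ _
  · have hxp : margin V a p ≤ margin V x p :=
      margin_le_of_forall_unimodal fun u hu => And.symm (hbetween x hx u hu)
    rw [points_of_neg (m := margin V p x) (by rw [margin_swap V x p]; omega)]
    exact points_nonneg hα₀ _
  · exact points_mono hα₀ hα₁ (margin_le_of_forall_unimodal (hright x hx))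

theorem IsCopelandWinner.margin_nonneg {L : List ℕ} (hL : L.Nodup) (hV : UnimodalOn L V)
    (hp : IsCopelandWinner α L.toFinset V p) (ha : a ∈ L) : 0 ≤ margin V p a := by
  by_contra! hlt
  have hpos : 0 < margin V a p := by rw [margin_swap V p a]; omega
  have hscore := (hp.2 a (List.mem_toFinset.2 ha)).not_gt
  obtain ⟨A, R, rfl⟩ := List.append_of_mem (List.mem_toFinset.1 hp.1)
  obtain ha | rfl | ha : a ∈ A ∨ a = p ∨ a ∈ R := by simpa using ha
  · obtain ⟨A, B, rfl⟩ := List.append_of_mem ha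
    have hreverse : (A ++ a :: B ++ p :: R).reverse =
        R.reverse ++ p :: (B.reverse ++ a :: A.reverse) := by simp
    have hV' := hV.reverse
    rw [← List.nodup_reverse] at hL
    rw [← List.toFinset_reverse] at hscore
    rw [hreverse] at hL hV' hscore
    exact hscore (copelandScore_lt_of_margin_pos hα₀ hα₁ hL hV' hpos)
  · rw [margin_swap] at hlt hpos
    omega
  · obtain ⟨B, D, rfl⟩ := List.append_of_mem ha
    exact hscore (copelandScore_lt_of_margin_pos hα₀ hα₁ hL hV hpos)

end Winner

/-! ### Votes without ties -/

section LinearVote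

/-- The vote that ranks the candidates in the order of the list. -/
def linearVote (O : List ℕ) : Vote := O.map fun a => [a]

variable {A R O : List ℕ} {p x : ℕ}

theorem position_linearVote (O : List ℕ) (a : ℕ) : position (linearVote O) a = O.idxOf a := by
  rw [position, linearVote, List.findIdx_map, List.idxOf]
  congr 1
  funext b
  rw [Bool.eq_iff_iff, Function.comp, decide_eq_true_iff, List.mem_singleton, beq_iff_eq, eq_comm]

theorem pairwise_prefers_linearVote (h : O.Nodup) : O.Pairwise (Prefers (linearVote O)) := by
  rw [List.pairwise_iff_getElem]
  intro i j hi hj hij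
  rwa [Prefers, position_linearVote, position_linearVote, h.idxOf_getElem, h.idxOf_getElem]

theorem prefers_linearVote_cons (h : x ≠ p) : Prefers (linearVote (p :: O)) p x := by
  rw [Prefers, position_linearVote, position_linearVote, List.idxOf_cons_self,
    List.idxOf_cons_ne _ h.symm]
  exact Nat.succ_pos _

theorem isWeakOrder_linearVote {L : List ℕ} (h : O.Perm L) : IsWeakOrder L (linearVote O) := by
  refine ⟨by simp [linearVote], ?_⟩
  rwa [linearVote, ← List.flatMap_def, List.flatMap_singleton']

theorem allows_linearVote (k : OrderKind) (O : List ℕ) : k.Allows (linearVote O) := by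
  have hsingleton : ∀ G ∈ linearVote O, G.length = 1 := by simp [linearVote]
  cases k with
  | top => exact fun G hG => hsingleton G (List.mem_of_mem_dropLast hG)
  | bottom => exact fun G hG => hsingleton G (List.mem_of_mem_tail hG)
  | weak => trivial

theorem singlePeaked_linearVote (hO : (p :: O).Nodup) (hA : A.reverse.Sublist O)
    (hR : R.Sublist O) : SinglePeaked (A ++ p :: R) (linearVote (p :: O)) := by
  have hpairwise := pairwise_prefers_linearVote hO
  refine ⟨A, p, R, by simp, fun a _ => ⟨?_, fun h => ?_⟩,
    List.pairwise_reverse.1 (hpairwise.sublist (hA.cons _)), hpairwise.sublist (hR.cons _)⟩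
  · rintro rfl b _ h
    rw [Prefers, position_linearVote, position_linearVote, List.idxOf_cons_self] at h
    exact Nat.not_lt_zero _ h
  · by_contra hap
    exact h p (by simp) (prefers_linearVote_cons hap)

theorem SinglePeaked.singlePlateaued {L : List ℕ} {v : Vote} (h : SinglePeaked L v) :
    SinglePlateaued L v := by
  obtain ⟨X, y, Z, hL, hy, hmono⟩ := h
  exact ⟨X, [y], Z, hL, by simpa using hy, hmono⟩

theorem Admissible.singlePlateaued {k : OrderKind} {s : Shape} {L : List ℕ} {v : Vote}
    (h : Admissible k s L v) : SinglePlateaued L v := by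
  cases s with
  | singlePeaked => exact SinglePeaked.singlePlateaued h.2.2
  | singlePlateaued => exact h.2.2

theorem unimodalOn_of_admissible {k : OrderKind} {s : Shape} {L : List ℕ} {V : Profile}
    (h : ∀ u ∈ V, Admissible k s L u.2) : UnimodalOn L V :=
  unimodalOn_iff.2 fun u hu => (h u hu).singlePlateaued.triplewise_unimodal

theorem admissible_linearVote (k : OrderKind) (s : Shape) (hL : (A ++ p :: R).Nodup)
    (hO : (p :: O).Perm (A ++ p :: R)) (hA : A.reverse.Sublist O) (hR : R.Sublist O) :
    Admissible k s (A ++ p :: R) (linearVote (p :: O)) := by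
  have hpeaked := singlePeaked_linearVote (hO.nodup_iff.2 hL) hA hR
  refine ⟨isWeakOrder_linearVote hO, allows_linearVote k _, ?_⟩
  cases s with
  | singlePeaked => exact hpeaked
  | singlePlateaued => exact hpeaked.singlePlateaued

theorem rightFirst_perm (A R : List ℕ) (p : ℕ) :
    (p :: (R ++ A.reverse)).Perm (A ++ p :: R) :=
  (List.perm_append_comm (l₁ := p :: R)).trans (A.reverse_perm.append_right _)

theorem leftFirst_perm (A R : List ℕ) (p : ℕ) :
    (p :: (A.reverse ++ R)).Perm (A ++ p :: R) :=
  ((A.reverse_perm.append_right R).cons p).trans List.perm_middle.symm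

end LinearVote

end TiedVoting

/-! ### Two ballots suffice -/

namespace TiedVoting

section Exchange

variable {A R : List ℕ} {N Z : Profile} {v : Vote} {c p x : ℕ}

theorem UnimodalOn.unanimous {L : List ℕ} (M : List ℕ) (h : SinglePlateaued L v) :
    UnimodalOn L (unanimous M v) := by
  rw [unimodalOn_iff, TiedVoting.unanimous]
  simpa using fun _ _ => h.triplewise_unimodal

theorem margin_le_margin_unanimous (hv : x ≠ p → Prefers v p x) :
    margin Z p x ≤ margin (unanimous (Z.map Prod.fst) v) p x := by
  rw [margin_unanimous]
  refine margin_le_sum_mul fun u _ => ?_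
  rcases eq_or_ne x p with rfl | hxp
  · rw [prefSign_self, prefSign_self]
  · rw [prefSign_eq_one.2 (hv hxp)]
    exact prefSign_le_one _ _ _

theorem prefers_linearVote_rightFirst {B : List ℕ} (hL : (A ++ c :: (B ++ p :: R)).Nodup)
    (hx : x ∈ B ++ p :: R) :
    Prefers (linearVote (p :: (R ++ (A ++ c :: B).reverse))) x c := by
  have hperm := rightFirst_perm (A ++ c :: B) R p
  rw [List.append_assoc, List.cons_append] at hperm
  have hpairwise := pairwise_prefers_linearVote (hperm.nodup_iff.2 hL)
  have hsplit : p :: (R ++ (A ++ c :: B).reverse) =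
      (p :: (R ++ B.reverse)) ++ c :: A.reverse := by simp
  rw [hsplit] at hpairwise ⊢
  exact (List.pairwise_append.1 hpairwise).2.2 x (by simp at hx ⊢; tauto) c (by simp)

theorem margin_rightFirst_le_margin (hL : (A ++ p :: R).Nodup) (hZ : UnimodalOn (A ++ p :: R) Z)
    (hc : c ∈ A) (hpc : ∀ u ∈ Z, Prefers u.2 p c) (hx : x ∈ A ++ p :: R) :
    margin (unanimous (Z.map Prod.fst) (linearVote (p :: (R ++ A.reverse)))) c x ≤
      margin Z c x := by
  obtain ⟨A, B, rfl⟩ := List.append_of_mem hc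
  rw [List.append_assoc, List.cons_append] at hL hZ hx
  rw [margin_unanimous]
  refine sum_mul_le_margin fun u hu => ?_
  rw [List.mem_append, List.mem_cons] at hx
  obtain hx | rfl | hx := hx
  · have hunimodal := (triplewise_append_cons_append_cons hZ).1 x hx u hu
    rw [prefSign_eq_one.2 (hunimodal.2 (hpc u hu))]
    exact prefSign_le_one _ _ _
  · rw [prefSign_self, prefSign_self]
  · rw [prefSign_eq_neg_one.2 (prefers_linearVote_rightFirst hL hx)]
    exact neg_one_le_prefSign _ _ _

theorem margin_eq_sum_of_nonneg {M : List ℕ} (hM : Z.map Prod.fst = M) (hv : Prefers v p c)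
    (hbefore : 0 ≤ margin (N ++ Z) p c) (hafter : 0 ≤ margin (N ++ unanimous M v) c p) :
    margin N c p = M.sum ∧ margin Z p c = M.sum := by
  have hle : margin Z p c ≤ (Z.map Prod.fst).sum * 1 :=
    margin_le_sum_mul fun u _ => prefSign_le_one _ _ _
  rw [margin_append, margin_unanimous, prefSign_eq_neg_one.2 hv] at hafter
  rw [margin_append, margin_swap N c p] at hbefore
  rw [hM] at hle
  omega

variable {α : ℚ} (hα₀ : 0 ≤ α) (hα₁ : α ≤ 1) (hL : (A ++ p :: R).Nodup)
  (hN : UnimodalOn (A ++ p :: R) N)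
include hα₀ hα₁ hL hN

/-- A winner `c ≠ p` of the new election does not lose to `p`, although now all manipulators prefer
`p` to `c`; as `p` did not lose to `c` before, they all had this preference already. Being unimodal,
they then also preferred `c` to all candidates further away from `p`, so `c` has gained no points,
while `p` has lost none. -/
theorem IsCopelandWinner.rightFirst (hZ : UnimodalOn (A ++ p :: R) Z) (hpos : ∀ u ∈ Z, 0 < u.1)
    (hlead : ∀ d ∈ R, margin N d p ≠ (Z.map Prod.fst).sum)
    (h : IsCopelandWinner α (A ++ p :: R).toFinset (N ++ Z) p) :
    IsCopelandWinner α (A ++ p :: R).toFinset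
      (N ++ unanimous (Z.map Prod.fst) (linearVote (p :: (R ++ A.reverse)))) p := by
  set v := linearVote (p :: (R ++ A.reverse))
  set M := Z.map Prod.fst with hM
  obtain ⟨c, hc, hmax⟩ := Finset.exists_max_image _
    (copelandScore α (A ++ p :: R).toFinset (N ++ unanimous M v)) ⟨p, h.1⟩
  refine ⟨h.1, fun x hx => (hmax x hx).trans ?_⟩
  rcases eq_or_ne c p with rfl | hne
  · rfl
  have hpeaked : SinglePeaked (A ++ p :: R) v :=
    singlePeaked_linearVote ((rightFirst_perm A R p).nodup_iff.2 hL) (List.sublist_append_right _ _)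
      (List.sublist_append_left _ _)
  obtain ⟨hNc, hZp⟩ := margin_eq_sum_of_nonneg hM.symm (prefers_linearVote_cons hne)
    (h.margin_nonneg hα₀ hα₁ hL (hN.append hZ) (List.mem_toFinset.1 hc))
    (IsCopelandWinner.margin_nonneg hα₀ hα₁ hL
      (hN.append (.unanimous M hpeaked.singlePlateaued)) ⟨hc, hmax⟩ (List.mem_toFinset.1 h.1))
  have hpc : ∀ u ∈ Z, Prefers u.2 p c := forall_prefers_of_margin_eq_sum hpos hZp
  have hcA : c ∈ A := by
    obtain hcp | hcA | hcR : c = p ∨ c ∈ A ∨ c ∈ R := by simpa using hc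
    exacts [absurd hcp hne, hcA, absurd hNc (hlead c hcR)]
  calc copelandScore α (A ++ p :: R).toFinset (N ++ unanimous M v) c
      ≤ copelandScore α (A ++ p :: R).toFinset (N ++ Z) c := by
        refine copelandScore_le_of_margin_le hα₀ hα₁ fun x hx => ?_
        rw [margin_append, margin_append, add_le_add_iff_left]
        exact margin_rightFirst_le_margin hL hZ hcA hpc (List.mem_toFinset.1 hx)
    _ ≤ copelandScore α (A ++ p :: R).toFinset (N ++ Z) p := h.2 c hc
    _ ≤ copelandScore α (A ++ p :: R).toFinset (N ++ unanimous M v) p := by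
        refine copelandScore_le_of_margin_le hα₀ hα₁ fun x _ => ?_
        rw [margin_append, margin_append, add_le_add_iff_left]
        exact margin_le_margin_unanimous prefers_linearVote_cons

end Exchange

section Ballot

/-- The vote that ranks `p` first, then the candidates to its right on the axis, then those to its
left, each by their distance from `p`. The mirror image `ballot L.reverse p` ranks the candidates on
the left second. -/
def ballot (L : List ℕ) (p : ℕ) : Vote :=
  linearVote (p :: ((L.dropWhile (· ≠ p)).tail ++ (L.takeWhile (· ≠ p)).reverse))

variable {A R : List ℕ} {p : ℕ}

theorem ballot_append_cons (hp : p ∉ A) :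
    ballot (A ++ p :: R) p = linearVote (p :: (R ++ A.reverse)) := by
  have hA : ∀ x ∈ A, decide (x ≠ p) = true := fun x hx =>
    decide_eq_true fun hxp => hp (hxp ▸ hx)
  rw [ballot, List.dropWhile_append_of_pos hA, List.takeWhile_append_of_pos hA,
    List.dropWhile_cons_of_neg (by simp), List.takeWhile_cons_of_neg (by simp), List.tail_cons,
    List.append_nil]

theorem reverse_append_cons (A R : List ℕ) (p : ℕ) :
    (A ++ p :: R).reverse = R.reverse ++ p :: A.reverse := by
  simp

theorem ballot_reverse_append_cons (hp : p ∉ R) :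
    ballot (A ++ p :: R).reverse p = linearVote (p :: (A.reverse ++ R)) := by
  rw [reverse_append_cons, ballot_append_cons (by simpa using hp), List.reverse_reverse]

theorem not_mem_of_nodup_append_cons (hL : (A ++ p :: R).Nodup) : p ∉ A ∧ p ∉ R := by
  simpa using (List.nodup_middle.1 hL).notMem

theorem admissible_ballot (k : OrderKind) (s : Shape) {L : List ℕ} (hL : L.Nodup) (hp : p ∈ L) :
    Admissible k s L (ballot L p) := by
  obtain ⟨A, R, rfl⟩ := List.append_of_mem hp
  rw [ballot_append_cons (not_mem_of_nodup_append_cons hL).1]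
  exact admissible_linearVote k s hL (rightFirst_perm A R p) (List.sublist_append_right _ _)
    (List.sublist_append_left _ _)

theorem admissible_ballot_reverse (k : OrderKind) (s : Shape) {L : List ℕ} (hL : L.Nodup)
    (hp : p ∈ L) : Admissible k s L (ballot L.reverse p) := by
  obtain ⟨A, R, rfl⟩ := List.append_of_mem hp
  rw [ballot_reverse_append_cons (not_mem_of_nodup_append_cons hL).2]
  exact admissible_linearVote k s hL (leftFirst_perm A R p) (List.sublist_append_left _ _)
    (List.sublist_append_right _ _)

end Ballot

section Manipulation

variable {α : ℚ} {k : OrderKind} {s : Shape} {L : List ℕ} {N Z : Profile} {p : ℕ}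

theorem UnimodalOn.of_append_cons {A R : List ℕ} {e d : ℕ} (h : UnimodalOn (A ++ p :: R) N)
    (he : e ∈ A) (hd : d ∈ R) : ∀ u ∈ N, Unimodal u.2 e p d := by
  rw [UnimodalOn, List.triplewise_append] at h
  exact (List.pairwise_cons.1 (h.2.2.1 e he)).1 d hd

theorem IsCopelandWinner.exists_ballot (hα₀ : 0 ≤ α) (hα₁ : α ≤ 1) (hL : L.Nodup)
    (hN : UnimodalOn L N) (hZ : UnimodalOn L Z) (hpos : ∀ u ∈ Z, 0 < u.1)
    (h : IsCopelandWinner α L.toFinset (N ++ Z) p) :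
    IsCopelandWinner α L.toFinset (N ++ unanimous (Z.map Prod.fst) (ballot L p)) p ∨
      IsCopelandWinner α L.toFinset (N ++ unanimous (Z.map Prod.fst) (ballot L.reverse p)) p := by
  rcases Z.eq_nil_or_concat with rfl | ⟨Z', u, hu⟩
  · exact .inl h
  have hsum : 0 < (Z.map Prod.fst).sum := by
    have hweight := hpos u (by simp [hu])
    simp only [hu, List.concat_eq_append, List.map_append, List.sum_append, List.map_cons,
      List.map_nil, List.sum_singleton]
    omega
  obtain ⟨A, R, rfl⟩ := List.append_of_mem (List.mem_toFinset.1 h.1)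
  obtain ⟨hpA, hpR⟩ := not_mem_of_nodup_append_cons hL
  rw [ballot_append_cons hpA]
  by_cases hright : ∃ d ∈ R, margin N d p = (Z.map Prod.fst).sum
  · obtain ⟨d, hd, hmargin⟩ := hright
    right
    rw [reverse_append_cons, ballot_append_cons (by simpa using hpR)]
    rw [← List.toFinset_reverse, reverse_append_cons] at h ⊢
    have hleft : ∀ e ∈ A.reverse, margin N e p ≠ (Z.map Prod.fst).sum := by
      intro e he heq
      have hle := margin_add_margin_le_zero (hN.of_append_cons (List.mem_reverse.1 he) hd)
      omega
    exact h.rightFirst hα₀ hα₁ (by rwa [← reverse_append_cons, List.nodup_reverse])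
      (by rw [← reverse_append_cons]; exact hN.reverse)
      (by rw [← reverse_append_cons]; exact hZ.reverse) hpos hleft
  · push Not at hright
    exact .inl (h.rightFirst hα₀ hα₁ hL hN hZ hpos hright)

theorem manipulable_of_unanimous {I : CWCMInstance} {v : Vote} (hv : Admissible k s I.axis v)
    (h : IsCopelandWinner α I.axis.toFinset
      (I.nonmanipulators ++ unanimous I.manipulators v) I.preferred) : I.Manipulable α k s := by
  refine ⟨I.manipulators.map fun _ => v, List.length_map _, by simpa using fun _ => hv, ?_⟩
  rwa [List.zip, List.zipWith_map_right, List.zipWith_self]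

theorem manipulable_iff (hα₀ : 0 ≤ α) (hα₁ : α ≤ 1) {I : CWCMInstance} (hI : I.Valid k s) :
    I.Manipulable α k s ↔
      IsCopelandWinner α I.axis.toFinset
          (I.nonmanipulators ++ unanimous I.manipulators (ballot I.axis I.preferred))
          I.preferred ∨
        IsCopelandWinner α I.axis.toFinset
          (I.nonmanipulators ++ unanimous I.manipulators (ballot I.axis.reverse I.preferred))
          I.preferred := by
  obtain ⟨hL, hp, hN, hM⟩ := hI
  refine ⟨fun ⟨votes, hlen, hvotes, hwin⟩ => ?_, ?_⟩
  · have hweights : (I.manipulators.zip votes).map Prod.fst = I.manipulators :=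
      List.map_fst_zip hlen.ge
    rw [← hweights]
    exact hwin.exists_ballot hα₀ hα₁ hL (unimodalOn_of_admissible fun u hu => (hN u hu).2)
      (unimodalOn_of_admissible fun u hu => hvotes _ (List.of_mem_zip hu).2)
      fun u hu => hM _ (List.of_mem_zip hu).1
  · exact Or.rec (manipulable_of_unanimous (admissible_ballot k s hL hp))
      (manipulable_of_unanimous (admissible_ballot_reverse k s hL hp))

end Manipulation

end TiedVoting

/-! ### Stack programs -/

namespace PolyTime

/-- Structured programs over stacks with alphabets `Γ k`. `cond` pops a symbol and branches on it,
`loop` pops symbols from a stack, running its body for each, until that stack is empty. -/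
inductive Prog {K : Type} (Γ : K → Type) : Type
  | skip : Prog Γ
  | push (k : K) (a : Γ k) : Prog Γ
  | seq (P Q : Prog Γ) : Prog Γ
  | cond (k : K) (P : Option (Γ k) → Prog Γ) : Prog Γ
  | loop (k : K) (P : Γ k → Prog Γ) : Prog Γ

/-- The contents of the stacks, topmost symbol first. -/
abbrev Stacks {K : Type} (Γ : K → Type) : Type := ∀ k, List (Γ k)

namespace Prog

open Turing

variable {K : Type} {Γ : K → Type}

/-- The control points of a program. -/
def Label : Prog Γ → Type
  | skip => Unit
  | push _ _ => Unit
  | seq P Q => P.Label ⊕ Q.Label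
  | cond _ P => Option (Σ o, (P o).Label)
  | loop _ P => Option (Σ a, (P a).Label)

/-- The control point at which a program starts. -/
def entry : (P : Prog Γ) → P.Label
  | skip => ()
  | push _ _ => ()
  | seq P _ => Sum.inl P.entry
  | cond _ _ => none
  | loop _ _ => none

instance finite_label [∀ k, Finite (Γ k)] : (P : Prog Γ) → Finite P.Label
  | skip => inferInstanceAs (Finite Unit)
  | push _ _ => inferInstanceAs (Finite Unit)
  | seq P Q =>
    have := finite_label P
    have := finite_label Q
    inferInstanceAs (Finite (P.Label ⊕ Q.Label))
  | cond _ P =>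
    have := fun o => finite_label (P o)
    inferInstanceAs (Finite (Option (Σ o, (P o).Label)))
  | loop _ P =>
    have := fun a => finite_label (P a)
    inferInstanceAs (Finite (Option (Σ a, (P a).Label)))

variable [DecidableEq K]

/-- `Run P S S' t`: started with stacks `S`, the program `P` ends with stacks `S'` after at most
`t` steps. -/
inductive Run : Prog Γ → Stacks Γ → Stacks Γ → ℕ → Prop
  | skip (S) : Run skip S S 1
  | push (k a S) : Run (push k a) S (Function.update S k (a :: S k)) 1
  | seq {P Q S S' S'' t t'} : Run P S S' t → Run Q S' S'' t' → Run (seq P Q) S S'' (t + t')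
  | cond {k P S S' t} : Run (P (S k).head?) (Function.update S k (S k).tail) S' t →
      Run (cond k P) S S' (t + 1)
  | loop_nil {k S} (P) : S k = [] → Run (loop k P) S S 1
  | loop_cons {k P S S' S'' a l t t'} : S k = a :: l → Run (P a) (Function.update S k l) S' t →
      Run (loop k P) S' S'' t' → Run (loop k P) S S'' (t + t' + 1)
  | mono {P S S' t t'} : Run P S S' t → t ≤ t' → Run P S S' t'

/-- A program that pushes a word onto a stack, leaving its first symbol on top. -/
def pushWord (k : K) : List (Γ k) → Prog Γ
  | [] => skip
  | a :: w => seq (pushWord k w) (push k a)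

theorem run_pushWord {k : K} (w : List (Γ k)) (S : Stacks Γ) :
    Run (pushWord k w) S (Function.update S k (w ++ S k)) (w.length + 1) := by
  induction w with
  | nil => simpa [pushWord] using Run.skip S
  | cons a w ih => simpa [pushWord] using ih.seq (.push k a _)

/-! ### Compilation to Turing machines -/

/-- The internal states of the compiled machines: the symbols last popped from the stacks. -/
abbrev Mem (Γ : K → Type) : Type := ∀ k, Option (Γ k)

variable {Λ : Type}

/-- The statement executed at a control point, where the control points are named by `e` and the
machine continues at `x` after the program. -/
def stmt : (P : Prog Γ) → (e : P.Label → Λ) → (x : Λ) → P.Label → TM2.Stmt Γ Λ (Mem Γ)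
  | skip, _, x, _ => .goto fun _ => x
  | push k a, _, x, _ => .push k (fun _ => a) (.goto fun _ => x)
  | seq P Q, e, x, l => match l with
    | Sum.inl l => P.stmt (fun l => e (Sum.inl l)) (e (Sum.inr Q.entry)) l
    | Sum.inr l => Q.stmt (fun l => e (Sum.inr l)) x l
  | cond k P, e, x, l => match l with
    | none => .pop k (fun v o => Function.update v k o)
        (.goto fun v => e (some ⟨v k, (P (v k)).entry⟩))
    | some ⟨o, l⟩ => (P o).stmt (fun l => e (some ⟨o, l⟩)) x l
  | loop k P, e, x, l => match l with
    | none => .pop k (fun v o => Function.update v k o)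
        (.goto fun v => match v k with
          | none => x
          | some a => e (some ⟨a, (P a).entry⟩))
    | some ⟨a, l⟩ => (P a).stmt (fun l => e (some ⟨a, l⟩)) (e none) l

/-- The machine `M` gets from `c` to `c'` in at most `t` steps. -/
def Reaches (M : Λ → TM2.Stmt Γ Λ (Mem Γ)) (c c' : TM2.Cfg Γ Λ (Mem Γ)) (t : ℕ) : Prop :=
  Nonempty (StateTransition.EvalsToInTime (TM2.step M) c (some c') t)

section Reaches

variable {M : Λ → TM2.Stmt Γ Λ (Mem Γ)} {c c' c'' : TM2.Cfg Γ Λ (Mem Γ)} {t t' : ℕ}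

theorem Reaches.trans : Reaches M c c' t → Reaches M c' c'' t' → Reaches M c c'' (t + t')
  | ⟨h⟩, ⟨h'⟩ => ⟨by simpa only [add_comm] using h.trans _ _ _ _ _ _ h'⟩

theorem Reaches.single (h : TM2.step M c = some c') : Reaches M c c' 1 :=
  ⟨⟨⟨1, h⟩, le_rfl⟩⟩

theorem Reaches.mono (ht : t ≤ t') : Reaches M c c' t → Reaches M c c' t'
  | ⟨h⟩ => ⟨⟨h.toEvalsTo, h.steps_le_m.trans ht⟩⟩

end Reaches

theorem Run.reaches {M : Λ → TM2.Stmt Γ Λ (Mem Γ)} {P : Prog Γ} {S S' : Stacks Γ} {t : ℕ}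
    (h : Run P S S' t) (e : P.Label → Λ) (x : Λ) (hM : ∀ l, M (e l) = P.stmt e x l) (v : Mem Γ) :
    ∃ v', Reaches M ⟨some (e P.entry), v, S⟩ ⟨some x, v', S'⟩ t := by
  induction h generalizing x v with
  | skip S => exact ⟨v, .single (by simp [TM2.step, hM, stmt])⟩
  | push k a S => exact ⟨v, .single (by simp [TM2.step, hM, stmt])⟩
  | @seq P Q S S' S'' t t' _ _ ihP ihQ =>
    obtain ⟨v', hP⟩ := ihP (fun l => e (Sum.inl l)) (e (Sum.inr Q.entry))
      (fun l => hM (Sum.inl l)) v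
    obtain ⟨v'', hQ⟩ := ihQ (fun l => e (Sum.inr l)) x (fun l => hM (Sum.inr l)) v'
    exact ⟨v'', hP.trans hQ⟩
  | @cond k P S S' t _ ih =>
    obtain ⟨v', hP⟩ := ih (fun l => e (some ⟨_, l⟩)) x (fun l => hM (some ⟨_, l⟩))
      (Function.update v k (S k).head?)
    refine ⟨v', add_comm 1 t ▸ Reaches.trans (.single ?_) hP⟩
    simp only [TM2.step, entry, hM none, stmt, TM2.stepAux, Option.some.injEq,
      TM2.Cfg.mk.injEq, and_true]
    exact congrArg (fun o => e (some ⟨o, (P o).entry⟩)) (Function.update_self ..)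
  | @loop_nil k S P hS =>
    have hupdate : Function.update S k [] = S := by rw [← hS, Function.update_eq_self]
    refine ⟨Function.update v k none, .single ?_⟩
    simp [TM2.step, entry, hM none, stmt, hS, hupdate]
  | @loop_cons k P S S' S'' a l t t' hS _ _ ihP ihLoop =>
    obtain ⟨v', hP⟩ := ihP (fun l => e (some ⟨a, l⟩)) (e none) (fun l => hM (some ⟨_, l⟩))
      (Function.update v k (some a))
    obtain ⟨v'', hLoop⟩ := ihLoop e x hM v'
    refine ⟨v'', add_comm 1 (t + t') ▸ Reaches.trans (.single ?_) (hP.trans hLoop)⟩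
    simp [TM2.step, entry, hM none, stmt, hS]
  | mono _ ht ih =>
    obtain ⟨v', hP⟩ := ih e x hM v
    exact ⟨v', hP.mono ht⟩

/-- The machine that runs a program, clears its internal state and halts. -/
noncomputable def machine [Fintype K] [∀ k, Fintype (Γ k)] (P : Prog Γ) (k₀ k₁ : K) : FinTM2 where
  K := K
  k₀ := k₀
  k₁ := k₁
  Γ := Γ
  Λ := Option P.Label
  main := some P.entry
  ΛFin := Fintype.ofFinite _
  σ := Mem Γ
  initialState := fun _ => none
  m := fun l => match l with
    | none => .load (fun _ _ => none) .halt
    | some l => P.stmt some none l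

theorem dite_eq_update (k₀ : K) (w : List (Γ k₀)) :
    (fun k => if h : k = k₀ then (by rw [h]; exact w : List (Γ k)) else []) =
      Function.update (fun _ => []) k₀ w := by
  funext k
  by_cases hk : k = k₀
  · subst hk
    simp
  · simp [hk]

theorem Run.outputsInTime [Fintype K] [∀ k, Fintype (Γ k)] {P : Prog Γ} {k₀ k₁ : K}
    {w : List (Γ k₀)} {o : List (Γ k₁)} {t : ℕ}
    (h : Run P (Function.update (fun _ => []) k₀ w) (Function.update (fun _ => []) k₁ o) t) :
    Nonempty (TM2OutputsInTime (P.machine k₀ k₁) w (some o) (t + 1)) := by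
  obtain ⟨v, hP⟩ := h.reaches (M := (P.machine k₀ k₁).m) some none (fun _ => rfl) fun _ => none
  have hHalt : Reaches (P.machine k₀ k₁).m ⟨some none, v, Function.update (fun _ => []) k₁ o⟩
      ⟨none, fun _ => none, Function.update (fun _ => []) k₁ o⟩ 1 :=
    .single (by simp [TM2.step, machine]; rfl)
  have hInit : initList (P.machine k₀ k₁) w =
      ⟨some (some P.entry), fun _ => none, Function.update (fun _ => []) k₀ w⟩ :=
    congrArg (TM2.Cfg.mk (some (some P.entry)) fun _ => none) (dite_eq_update k₀ w)
  have hFinal : haltList (P.machine k₀ k₁) o =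
      ⟨none, fun _ => none, Function.update (fun _ => []) k₁ o⟩ :=
    congrArg (TM2.Cfg.mk none fun _ => none) (dite_eq_update k₁ o)
  change Nonempty (StateTransition.EvalsToInTime _ (initList (P.machine k₀ k₁) w)
    (some (haltList (P.machine k₀ k₁) o)) _)
  rw [hInit, hFinal]
  exact hP.trans hHalt

end Prog

end PolyTime

/-! ### Trees on stacks -/

namespace PolyTime

open Prog

/-- Binary trees, the universal data type of the programs below. -/
inductive Tree : Type
  | leaf : Tree
  | node (a b : Tree) : Tree

/-- Prefix notation of a tree; no such word is a proper prefix of another one. -/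
def Tree.word : Tree → List Bool
  | leaf => [false]
  | node a b => true :: (a.word ++ b.word)

/-- The stacks of the machines: `tree false` is the work stack, which also receives the output,
`tree true` saves trees for later use, `aux` and `cnt` are used in moving trees, and `inp` holds
the input. -/
inductive Reg : Type
  | tree (side : Bool)
  | aux
  | cnt
  | inp
  deriving DecidableEq, Fintype

/-- The stack alphabets. -/
@[reducible] def Alph : Reg → Type
  | .inp => TiedVoting.Symbol
  | _ => Bool

instance : (k : Reg) → Fintype (Alph k)
  | .tree _ => inferInstanceAs (Fintype Bool)
  | .aux => inferInstanceAs (Fintype Bool)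
  | .cnt => inferInstanceAs (Fintype Bool)
  | .inp => inferInstanceAs (Fintype Computability.Γ')

/-- The stacks with contents `m` on `tree k`, `s` on `tree !k`, `a` on `aux`, `c` on `cnt` and `i`
on `inp`. -/
def contents (k : Bool) (m s a c : List Bool) (i : List TiedVoting.Symbol) : Stacks Alph
  | .tree j => if j = k then m else s
  | .aux => a
  | .cnt => c
  | .inp => i

section Steps

variable {k : Bool} {m s a c : List Bool} {i : List TiedVoting.Symbol}

theorem contents_not : contents (!k) m s a c i = contents k s m a c i := by
  funext j
  rcases j with j | _ | _ | _ <;> try rfl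
  cases j <;> cases k <;> rfl

@[simp] theorem update_contents_tree (x : List Bool) :
    Function.update (contents k m s a c i) (.tree k) x = contents k x s a c i := by
  funext j
  rcases j with j | _ | _ | _ <;> try rfl
  cases j <;> cases k <;> rfl

@[simp] theorem update_contents_aux (x : List Bool) :
    Function.update (contents k m s a c i) .aux x = contents k m s x c i := by
  funext j; cases j <;> rfl

@[simp] theorem update_contents_cnt (x : List Bool) :
    Function.update (contents k m s a c i) .cnt x = contents k m s a x i := by
  funext j; cases j <;> rfl

@[simp] theorem update_contents_inp (x : List TiedVoting.Symbol) :
    Function.update (contents k m s a c i) .inp x = contents k m s a c x := by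
  funext j; cases j <;> rfl

@[simp] theorem contents_tree : contents k m s a c i (.tree k) = m := if_pos rfl

theorem run_push_tree (k b : Bool) :
    Run (push (.tree k) b) (contents k m s a c i) (contents k (b :: m) s a c i) 1 := by
  simpa using! Run.push (Γ := Alph) (.tree k) b (contents k m s a c i)

theorem run_push_tree_not (k b : Bool) :
    Run (push (.tree !k) b) (contents k m s a c i) (contents k m (b :: s) a c i) 1 := by
  simpa only [contents_not] using run_push_tree (!k) b

theorem run_push_aux (b : Bool) :
    Run (push .aux b) (contents k m s a c i) (contents k m s (b :: a) c i) 1 := by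
  simpa using! Run.push (Γ := Alph) .aux b (contents k m s a c i)

theorem run_push_cnt (b : Bool) :
    Run (push .cnt b) (contents k m s a c i) (contents k m s a (b :: c) i) 1 := by
  simpa using! Run.push (Γ := Alph) .cnt b (contents k m s a c i)

theorem run_cond_tree {b : Bool} {P : Option Bool → Prog Alph} {S : Stacks Alph} {t : ℕ}
    (h : Run (P (some b)) (contents k m s a c i) S t) :
    Run (cond (.tree k) P) (contents k (b :: m) s a c i) S (t + 1) :=
  .cond (by simpa using! h)

section Loop

variable {S S' : Stacks Alph} {t t' : ℕ}

theorem run_loop_aux {b : Bool} {P : Bool → Prog Alph} (h : Run (P b) (contents k m s a c i) S t)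
    (hloop : Run (loop .aux P) S S' t') :
    Run (loop .aux P) (contents k m s (b :: a) c i) S' (t + t' + 1) :=
  .loop_cons (a := b) (l := a) rfl (by simpa using! h) hloop

theorem run_loop_cnt {b : Bool} {P : Bool → Prog Alph} (h : Run (P b) (contents k m s a c i) S t)
    (hloop : Run (loop .cnt P) S S' t') :
    Run (loop .cnt P) (contents k m s a (b :: c) i) S' (t + t' + 1) :=
  .loop_cons (a := b) (l := c) rfl (by simpa using! h) hloop

theorem run_loop_inp {x : TiedVoting.Symbol} {P : TiedVoting.Symbol → Prog Alph}
    (h : Run (P x) (contents k m s a c i) S t) (hloop : Run (loop .inp P) S S' t') :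
    Run (loop .inp P) (contents k m s a c (x :: i)) S' (t + t' + 1) :=
  .loop_cons (a := x) (l := i) rfl (by simpa using! h) hloop

end Loop

end Steps

/-- One step of the traversal of a tree, given its next symbol. -/
def grabStep : Option Bool → Prog Alph
  | some true => seq (push .aux true) (seq (push .cnt true) (push .cnt true))
  | some false => push .aux false
  | none => skip

/-- Move as many trees as there are marks on `cnt` from `tree k`, in reverse, to `aux`. -/
def grabLoop (k : Bool) : Prog Alph := loop .cnt fun _ => cond (.tree k) grabStep

theorem run_grabLoop (x : Tree) {k m s a c i S t}
    (h : Run (grabLoop k) (contents k m s (x.word.reverse ++ a) c i) S t) :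
    Run (grabLoop k) (contents k (x.word ++ m) s a (true :: c) i) S (t + 5 * x.word.length) := by
  induction x generalizing m a c t with
  | leaf =>
    refine (run_loop_cnt (run_cond_tree (run_push_aux false)) h).mono ?_
    simp only [Tree.word, List.length_singleton]
    omega
  | node x y ihx ihy =>
    simp only [Tree.word, List.reverse_cons, List.reverse_append, List.append_assoc] at h
    have hChildren : Run (grabLoop k)
        (contents k ((x.word ++ y.word) ++ m) s (true :: a) (true :: true :: c) i) S
        (t + 5 * y.word.length + 5 * x.word.length) := by
      simpa using ihx (ihy h)
    refine (run_loop_cnt (run_cond_tree ((run_push_aux true).seq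
      ((run_push_cnt true).seq (run_push_cnt true)))) hChildren).mono ?_
    simp only [Tree.word, List.length_cons, List.length_append]
    omega

/-- Move a tree from `tree k`, in reverse, to `aux`. -/
def grab (k : Bool) : Prog Alph := seq (push .cnt true) (grabLoop k)

theorem run_grab (k : Bool) (x : Tree) {m s a i} :
    Run (grab k) (contents k (x.word ++ m) s a [] i) (contents k m s (x.word.reverse ++ a) [] i)
      (5 * x.word.length + 2) :=
  ((run_push_cnt true).seq (run_grabLoop x (.loop_nil _ rfl))).mono (by omega)

/-- Empty `aux` onto `tree k` (if `p`) and onto `tree !k` (if `q`). -/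
def unload (k p q : Bool) : Prog Alph :=
  loop .aux fun b =>
    seq (if p then push (.tree k) b else skip) (if q then push (.tree !k) b else skip)

theorem run_unload (k p q : Bool) (l : List Bool) {m s c i} :
    Run (unload k p q) (contents k m s l c i)
      (contents k (if p then l.reverse ++ m else m) (if q then l.reverse ++ s else s) [] c i)
      (3 * l.length + 1) := by
  induction l generalizing m s with
  | nil =>
    simp only [List.reverse_nil, List.nil_append, ite_self]
    exact .loop_nil _ rfl
  | cons b l ih =>
    have hp : Run (if p then push (.tree k) b else skip) (contents k m s l c i)
        (contents k (if p then b :: m else m) s l c i) 1 := by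
      cases p
      · exact .skip _
      · exact run_push_tree k b
    have hq : ∀ {m}, Run (if q then push (.tree !k) b else skip) (contents k m s l c i)
        (contents k m (if q then b :: s else s) l c i) 1 := by
      cases q
      · exact .skip _
      · exact run_push_tree_not k b
    have ht : 1 + 1 + (3 * l.length + 1) + 1 ≤ 3 * (b :: l).length + 1 := by
      rw [List.length_cons]
      omega
    refine Run.mono ?_ ht
    have h := run_loop_aux (hp.seq hq) ih
    cases p <;> cases q <;> simpa [unload] using h

/-- Move the tree on `tree k` to `tree k` (if `p`) and to `tree !k` (if `q`). -/
def transfer (k p q : Bool) : Prog Alph := seq (grab k) (unload k p q)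

theorem run_transfer (k p q : Bool) (x : Tree) {m s i} :
    Run (transfer k p q) (contents k (x.word ++ m) s [] [] i)
      (contents k (if p then x.word ++ m else m) (if q then x.word ++ s else s) [] [] i)
      (8 * x.word.length + 3) := by
  have h := (run_grab k x (m := m) (s := s) (a := []) (i := i)).seq (run_unload k p q _)
  simp only [List.append_nil, List.reverse_reverse, List.length_reverse] at h
  exact h.mono (by omega)

/-! ### Encoding data by trees -/

/-- Types whose elements are represented by trees. The representation need not be injective. -/
class Enc (α : Type) where
  tree : α → Tree

/-- The word that represents `a` on the stacks. -/
def code {α : Type} [Enc α] (a : α) : List Bool := (Enc.tree a).word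

/-- The length of the code of `a`. -/
def size {α : Type} [Enc α] (a : α) : ℕ := (code a).length

instance : Enc Bool where
  tree b := if b then .node .leaf .leaf else .leaf

instance {α β : Type} [Enc α] [Enc β] : Enc (α × β) where
  tree p := .node (Enc.tree p.1) (Enc.tree p.2)

/-- The comb whose teeth are the trees of the entries. -/
def listTree {α : Type} [Enc α] : List α → Tree
  | [] => .leaf
  | a :: l => .node (Enc.tree a) (listTree l)

instance {α : Type} [Enc α] : Enc (List α) where
  tree := listTree

section Size

variable {α β : Type} [Enc α] [Enc β]

theorem code_true : code true = [true, false, false] := rfl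

theorem code_false : code false = [false] := rfl

theorem code_pair (a : α) (b : β) : code (a, b) = true :: (code a ++ code b) := rfl

theorem code_nil : code ([] : List α) = [false] := rfl

theorem code_cons (a : α) (l : List α) : code (a :: l) = true :: (code a ++ code l) := rfl

theorem code_list (l : List α) : code l = l.flatMap (fun a => true :: code a) ++ [false] := by
  induction l with
  | nil => rfl
  | cons a l ih => simp [code_cons, ih]

theorem size_bool_le (b : Bool) : size b ≤ 3 := by
  cases b <;> simp [size, code_true, code_false]

@[simp] theorem size_pair (a : α) (b : β) : size (a, b) = size a + size b + 1 := by
  simp [size, code_pair]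

@[simp] theorem size_nil : size ([] : List α) = 1 := rfl

@[simp] theorem size_cons (a : α) (l : List α) : size (a :: l) = size a + size l + 1 := by
  simp [size, code_cons]

theorem one_le_size (a : α) : 1 ≤ size a := by
  simp only [size, code]
  cases Enc.tree a <;> simp [Tree.word]

theorem size_le_of_mem {a : α} {l : List α} (h : a ∈ l) : size a ≤ size l := by
  induction l with
  | nil => simp at h
  | cons b l ih =>
    rw [size_cons]
    rcases List.mem_cons.1 h with rfl | h
    · omega
    · have := ih h
      omega

theorem length_le_size (l : List α) : l.length ≤ size l := by
  induction l with
  | nil => simp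
  | cons b l ih =>
    rw [List.length_cons, size_cons]
    omega

@[simp] theorem size_append (l l' : List α) : size (l ++ l') + 1 = size l + size l' := by
  induction l with
  | nil =>
    rw [List.nil_append, size_nil]
    omega
  | cons b l ih =>
    rw [List.cons_append, size_cons, size_cons]
    omega

end Size

end PolyTime

/-! ### Polynomial bounds -/

namespace PolyTime

open Prog

/-- `t` is bounded by a polynomial in `μ`. -/
def PolyBdd {ι : Type} (μ t : ι → ℕ) : Prop := ∃ P : Polynomial ℕ, ∀ i, t i ≤ P.eval (μ i)

theorem eval_monotone (P : Polynomial ℕ) : Monotone fun n => P.eval n := by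
  intro m n h
  simp only [Polynomial.eval_eq_sum_range]
  gcongr

namespace PolyBdd

variable {ι κ : Type} {μ t t' : ι → ℕ}

theorem mono (h : PolyBdd μ t') (ht : ∀ i, t i ≤ t' i) : PolyBdd μ t :=
  h.imp fun _ hP i => (ht i).trans (hP i)

protected theorem refl (μ : ι → ℕ) : PolyBdd μ μ := ⟨Polynomial.X, fun i => by simp⟩

theorem const (n : ℕ) : PolyBdd μ fun _ => n := ⟨Polynomial.C n, fun i => by simp⟩

theorem add : PolyBdd μ t → PolyBdd μ t' → PolyBdd μ fun i => t i + t' i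
  | ⟨P, hP⟩, ⟨Q, hQ⟩ => ⟨P + Q, fun i => by simpa using Nat.add_le_add (hP i) (hQ i)⟩

theorem mul : PolyBdd μ t → PolyBdd μ t' → PolyBdd μ fun i => t i * t' i
  | ⟨P, hP⟩, ⟨Q, hQ⟩ => ⟨P * Q, fun i => by simpa using Nat.mul_le_mul (hP i) (hQ i)⟩

theorem trans {ν : κ → ℕ} {u : κ → ℕ} (hu : PolyBdd ν u) {f : ι → κ}
    (hf : PolyBdd μ fun i => ν (f i)) : PolyBdd μ fun i => u (f i) := by
  obtain ⟨P, hP⟩ := hf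
  obtain ⟨Q, hQ⟩ := hu
  exact ⟨Q.comp P, fun i => (hQ _).trans (by simpa using eval_monotone Q (hP i))⟩

end PolyBdd

/-- For each index `i`, the program `p` started with stacks `S i` ends with stacks `S' i`, after a
number of steps that is bounded by a polynomial in `μ i`. -/
def PolyRun {ι : Type} (μ : ι → ℕ) (p : Prog Alph) (S S' : ι → Stacks Alph) : Prop :=
  ∃ t, PolyBdd μ t ∧ ∀ i, Run p (S i) (S' i) (t i)

namespace PolyRun

variable {ι κ : Type} {μ : ι → ℕ} {p q : Prog Alph} {S S' S'' : ι → Stacks Alph}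

theorem seq : PolyRun μ p S S' → PolyRun μ q S' S'' → PolyRun μ (seq p q) S S''
  | ⟨_, ht, hp⟩, ⟨_, hu, hq⟩ => ⟨_, ht.add hu, fun i => (hp i).seq (hq i)⟩

theorem reindex {ν : κ → ℕ} {T T' : κ → Stacks Alph} (h : PolyRun ν p T T') {f : ι → κ}
    (hf : PolyBdd μ fun i => ν (f i)) : PolyRun μ p (fun i => T (f i)) fun i => T' (f i) :=
  let ⟨_, ht, hp⟩ := h
  ⟨_, ht.trans hf, fun i => hp (f i)⟩

theorem congr (h : PolyRun μ p S S') {T T' : ι → Stacks Alph} (hS : ∀ i, S i = T i)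
    (hS' : ∀ i, S' i = T' i) : PolyRun μ p T T' := by
  rwa [← funext hS, ← funext hS']

theorem push (k b : Bool) (m s : ι → List Bool) (a c i) :
    PolyRun μ (push (.tree k) b) (fun j => contents k (m j) (s j) a c i)
      fun j => contents k (b :: m j) (s j) a c i :=
  ⟨_, .const 1, fun _ => run_push_tree k b⟩

theorem cond {k b : Bool} {P : Option Bool → Prog Alph} {m s : ι → List Bool} {a c i}
    (h : PolyRun μ (P (some b)) (fun j => contents k (m j) (s j) a c i) S) :
    PolyRun μ (cond (.tree k) P) (fun j => contents k (b :: m j) (s j) a c i) S :=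
  let ⟨_, ht, hP⟩ := h
  ⟨_, ht.add (.const 1), fun i => run_cond_tree (hP i)⟩

theorem of_cover {κ' : Type} {f : κ → ι} {f' : κ' → ι}
    (hcover : ∀ i, (∃ k, f k = i) ∨ ∃ k, f' k = i)
    (h : PolyRun (fun k => μ (f k)) p (fun k => S (f k)) fun k => S' (f k))
    (h' : PolyRun (fun k => μ (f' k)) p (fun k => S (f' k)) fun k => S' (f' k)) :
    PolyRun μ p S S' := by
  obtain ⟨_, ⟨P, hP⟩, h⟩ := h
  obtain ⟨_, ⟨Q, hQ⟩, h'⟩ := h'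
  refine ⟨fun i => (P + Q).eval (μ i), ⟨P + Q, fun _ => le_rfl⟩, fun i => ?_⟩
  simp only [Polynomial.eval_add]
  rcases hcover i with ⟨k, rfl⟩ | ⟨k, rfl⟩
  · exact (h k).mono (le_add_of_le_left (hP k))
  · exact (h' k).mono (le_add_of_le_right (hQ k))

end PolyRun

/-! ### Functions computable in polynomial time -/

/-- The stacks between the execution of subprograms. -/
abbrev conf (m s : List Bool) : Stacks Alph := contents false m s [] [] []

section Computes

variable {α β ι : Type} [Enc α] [Enc β]

/-- A value on top of the work stack, the rest of the work stack, and the saved trees. -/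
abbrev Ctx (α : Type) : Type := α × List Bool × List Bool

theorem PolyBdd.ctx {t : α → ℕ} (h : PolyBdd size t) :
    PolyBdd (fun x : Ctx α => size x.1) fun x => t x.1 :=
  h.trans (.refl _)

/-- In polynomial time, `p` replaces the code of `a` on top of the work stack by the code of
`f a`. -/
def Computes (p : Prog Alph) (f : α → β) : Prop :=
  PolyRun (fun x : Ctx α => size x.1) p
    (fun x => conf (code x.1 ++ x.2.1) x.2.2) fun x => conf (code (f x.1) ++ x.2.1) x.2.2

variable {μ : ι → ℕ} {g : ι → α}

theorem Computes.polyRun {p : Prog Alph} {f : α → β} (h : Computes p f)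
    (hg : PolyBdd μ fun i => size (g i)) (m s : ι → List Bool) :
    PolyRun μ p (fun i => conf (code (g i) ++ m i) (s i))
      fun i => conf (code (f (g i)) ++ m i) (s i) :=
  PolyRun.reindex h (f := fun i => (g i, m i, s i)) hg

theorem polyRun_transfer (k p q : Bool) (hg : PolyBdd μ fun i => size (g i))
    (m s : ι → List Bool) :
    PolyRun μ (transfer k p q) (fun i => contents k (code (g i) ++ m i) (s i) [] [] [])
      fun i => contents k (if p then code (g i) ++ m i else m i)
        (if q then code (g i) ++ s i else s i) [] [] [] :=
  ⟨_, ((PolyBdd.const 8).mul hg).add (.const 3), fun _ => run_transfer k p q _⟩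

variable (hg : PolyBdd μ fun i => size (g i)) (m s : ι → List Bool)
include hg

theorem polyRun_copy : PolyRun μ (transfer false true true)
    (fun i => conf (code (g i) ++ m i) (s i))
    fun i => conf (code (g i) ++ m i) (code (g i) ++ s i) :=
  polyRun_transfer false true true hg m s

theorem polyRun_drop : PolyRun μ (transfer false false false)
    (fun i => conf (code (g i) ++ m i) (s i)) fun i => conf (m i) (s i) :=
  polyRun_transfer false false false hg m s

theorem polyRun_save : PolyRun μ (transfer false false true)
    (fun i => conf (code (g i) ++ m i) (s i)) fun i => conf (m i) (code (g i) ++ s i) :=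
  polyRun_transfer false false true hg m s

theorem polyRun_restore : PolyRun μ (transfer true false true)
    (fun i => conf (m i) (code (g i) ++ s i)) fun i => conf (code (g i) ++ m i) (s i) := by
  simpa only [conf, ← contents_not (k := false)] using! polyRun_transfer true false true hg s m

end Computes

/-- `f` is computable in polynomial time. The bound on the size of the values already follows from
the one on the number of steps, but it is easier to carry it along. -/
@[fun_prop] def Poly {α β : Type} [Enc α] [Enc β] (f : α → β) : Prop :=
  PolyBdd size (fun a => size (f a)) ∧ ∃ p, Computes p f

namespace Poly

variable {α β γ : Type} [Enc α] [Enc β] [Enc γ]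

theorem of_eq {f g : α → β} (hf : Poly f) (h : ∀ a, f a = g a) : Poly g := funext h ▸ hf

theorem of_tree_eq {f : α → β} (hf : Poly f) {g : α → γ}
    (h : ∀ a, Enc.tree (g a) = Enc.tree (f a)) : Poly g := by
  obtain ⟨hsize, p, hp⟩ := hf
  refine ⟨?_, p, ?_⟩
  · simpa only [size, code, h] using hsize
  · simpa only [Computes, code, h] using hp

@[fun_prop] theorem id : Poly fun a : α => a :=
  ⟨.refl _, skip, _, .const 1, fun _ => .skip _⟩

@[fun_prop] theorem comp {g : β → γ} {f : α → β} : Poly g → Poly f → Poly fun a => g (f a)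
  | ⟨hg, _, hq⟩, ⟨hf, _, hp⟩ =>
    ⟨hg.trans hf, _, PolyRun.seq hp (hq.polyRun hf.ctx _ _)⟩

@[fun_prop] theorem const (b : β) : Poly fun _ : α => b := by
  refine ⟨.const _, .seq (transfer false false false) (pushWord (.tree false) (code b)), ?_⟩
  refine (polyRun_drop (.refl _) _ _).seq ⟨_, .const ((code b).length + 1), fun x => ?_⟩
  simpa using! run_pushWord (Γ := Alph) (k := .tree false) (code b) (conf x.2.1 x.2.2)

@[fun_prop] theorem pair {f : α → β} {g : α → γ} : Poly f → Poly g → Poly fun a => (f a, g a)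
  | ⟨hf, p, hp⟩, ⟨hg, q, hq⟩ => by
    refine ⟨((hf.add hg).add (.const 1)).mono fun a => (size_pair _ _).le,
      .seq (transfer false true true) (.seq q (.seq (transfer true false true)
        (.seq p (.push (.tree false) true)))), ?_⟩
    refine ((polyRun_copy (.refl _) _ _).seq ((hq.polyRun (.refl _) _ _).seq
      ((polyRun_restore (.refl _) _ _).seq ((hp.polyRun (.refl _) _ _).seq
        (.push false true _ _ _ _ _))))).congr (fun _ => rfl) fun x => ?_
    simp [code_pair]

theorem size_fst_le (x : α × β) : size x.1 ≤ size x := by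
  rw [size_pair]
  omega

theorem size_snd_le (x : α × β) : size x.2 ≤ size x := by
  rw [size_pair]
  omega

theorem prodFst : Poly fun x : α × β => x.1 := by
  have hfst := (PolyBdd.refl (size (α := α × β))).mono size_fst_le
  have hsnd := (PolyBdd.refl (size (α := α × β))).mono size_snd_le
  refine ⟨hfst, .cond (.tree false) fun _ => .seq (transfer false false true)
    (.seq (transfer false false false) (transfer true false true)), ?_⟩
  have hrun := (polyRun_save hfst.ctx (fun x => code x.1.2 ++ x.2.1) fun x => x.2.2).seq
    ((polyRun_drop hsnd.ctx _ _).seq (polyRun_restore hfst.ctx _ _))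
  exact PolyRun.congr (.cond (b := true) hrun) (fun _ => by rw [code_pair]; simp) fun _ => rfl

theorem prodSnd : Poly fun x : α × β => x.2 := by
  have hfst := (PolyBdd.refl (size (α := α × β))).mono size_fst_le
  have hsnd := (PolyBdd.refl (size (α := α × β))).mono size_snd_le
  refine ⟨hsnd, .cond (.tree false) fun _ => transfer false false false, ?_⟩
  have hrun := polyRun_drop hfst.ctx (fun x => code x.1.2 ++ x.2.1) fun x => x.2.2
  exact PolyRun.congr (.cond (b := true) hrun) (fun _ => by rw [code_pair]; simp) fun _ => rfl

@[fun_prop] theorem fst {f : α → β × γ} (hf : Poly f) : Poly fun a => (f a).1 := prodFst.comp hf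

@[fun_prop] theorem snd {f : α → β × γ} (hf : Poly f) : Poly fun a => (f a).2 := prodSnd.comp hf

@[fun_prop] theorem ite {c : α → Bool} {f g : α → β} :
    Poly c → Poly f → Poly g → Poly fun a => if c a then f a else g a
  | ⟨_, z, hz⟩, ⟨hf, p, hp⟩, ⟨hg, q, hq⟩ => by
    let branch : Option Bool → Prog Alph
      | some true => .cond (.tree false) fun _ => .cond (.tree false) fun _ =>
          .seq (transfer true false true) p
      | _ => .seq (transfer true false true) q
    refine ⟨(hf.add hg).mono fun a => ?_,
      .seq (transfer false true true) (.seq z (.cond (.tree false) branch)), ?_⟩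
    · dsimp only
      split <;> omega
    refine (polyRun_copy (.refl _) _ _).seq ((hz.polyRun (.refl _) _ _).seq ?_)
    refine PolyRun.of_cover (f := fun x : {x : Ctx α // c x.1 = true} => x.1)
      (f' := fun x : {x : Ctx α // c x.1 = false} => x.1) (fun x => ?_) ?_ ?_
    · simp
    · have hrun := (polyRun_restore (.refl fun x : {x : Ctx α // c x.1 = true} => size x.1.1)
        (fun x => x.1.2.1) fun x => x.1.2.2).seq (hp.polyRun (.refl _) _ _)
      refine PolyRun.congr (.cond (b := true) (.cond (b := false) (.cond (b := false) hrun)))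
        (fun x => ?_) fun x => ?_
      · rw [x.2, code_true, List.cons_append, List.cons_append, List.cons_append, List.nil_append]
      · simp only [x.2, if_true]
    · have hrun := (polyRun_restore (.refl fun x : {x : Ctx α // c x.1 = false} => size x.1.1)
        (fun x => x.1.2.1) fun x => x.1.2.2).seq (hq.polyRun (.refl _) _ _)
      refine PolyRun.congr (.cond (b := false) hrun) (fun x => ?_) fun x => ?_
      · rw [x.2, code_false, List.cons_append, List.nil_append]
      · simp only [x.2, Bool.false_eq_true, if_false]

theorem polyBdd_size_list_cases {f : α → List β} {g : α → γ} {h : α → β → List β → γ}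
    (hf : PolyBdd size fun a => size (f a)) (hg : PolyBdd size fun a => size (g a))
    (hh : PolyBdd size fun x : α × β × List β => size (h x.1 x.2.1 x.2.2)) :
    PolyBdd size fun a => size (match f a with
      | [] => g a
      | b :: l => h a b l : γ) := by
  obtain ⟨H, hH⟩ := hh
  have hargs : PolyBdd size fun a => size a + size (f a) + 1 :=
    ((PolyBdd.refl size).add hf).add (.const 1)
  refine (hg.add (PolyBdd.trans ⟨H, fun _ => le_rfl⟩ hargs)).mono fun a => ?_
  rcases hfa : f a with _ | ⟨b, l⟩
  · exact Nat.le_add_right _ _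
  · refine le_add_of_le_right ?_
    simpa only [hfa, size_pair, size_cons, ← add_assoc] using hH (a, b, l)

theorem list_cases {f : α → List β} {g : α → γ} {h : α → β → List β → γ} :
    Poly f → Poly g → (Poly fun x : α × β × List β => h x.1 x.2.1 x.2.2) →
      Poly fun a => (match f a with
        | [] => g a
        | b :: l => h a b l : γ)
  | ⟨hf, z, hz⟩, ⟨hg, p, hp⟩, ⟨hh, q, hq⟩ => by
    let Nil : Type := {x : Ctx α // f x.1 = []}
    let Cons : Type := {x : Ctx α × β × List β // f x.1.1 = x.2.1 :: x.2.2}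
    let branch : Option Bool → Prog Alph
      | some true => .seq (.push (.tree false) true) (.seq (transfer true false true)
          (.seq (.push (.tree false) true) q))
      | _ => .seq (transfer true false true) p
    refine ⟨polyBdd_size_list_cases hf hg hh,
      .seq (transfer false true true) (.seq z (.cond (.tree false) branch)), ?_⟩
    refine (polyRun_copy (.refl _) _ _).seq ((hz.polyRun (.refl _) _ _).seq ?_)
    refine PolyRun.of_cover (f := fun x : Nil => x.1) (f' := fun x : Cons => x.1.1)
      (fun x => ?_) ?_ ?_
    · rcases hfx : f x.1 with _ | ⟨b, l⟩
      · exact .inl ⟨⟨x, hfx⟩, rfl⟩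
      · exact .inr ⟨⟨(x, b, l), hfx⟩, rfl⟩
    · have hrun := (polyRun_restore (.refl fun x : Nil => size x.1.1)
        (fun x => x.1.2.1) fun x => x.1.2.2).seq (hp.polyRun (.refl _) _ _)
      refine PolyRun.congr (.cond (b := false) hrun) (fun x => ?_) fun x => ?_
      · rw [x.2, code_nil, List.cons_append, List.nil_append]
      · simp only [x.2]
    · have hcons : PolyBdd (fun x : Cons => size x.1.1.1) fun x => size (x.1.1.1, x.1.2) :=
        ((((PolyBdd.refl size).add hf).add (.const 1)).trans (.refl _)).mono fun x => by
          rw [size_pair, size_pair, x.2, size_cons]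
      have hvalue := (hq.polyRun hcons (fun x => x.1.1.2.1) fun x => x.1.1.2.2).congr
        (T := fun x => conf (true :: (code x.1.1.1 ++
          true :: (code x.1.2.1 ++ code x.1.2.2 ++ x.1.1.2.1))) x.1.1.2.2)
        (fun x => by rw [code_pair, ← x.1.2.eta, code_pair]; simp) fun _ => rfl
      have hrun := (PolyRun.push false true _ _ [] [] []).seq
        ((polyRun_restore (.refl _) _ _).seq ((PolyRun.push false true _ _ [] [] []).seq hvalue))
      refine PolyRun.congr (.cond (b := true) hrun) (fun x => ?_) fun x => ?_
      · rw [x.2, code_cons, List.cons_append]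
      · simp only [x.2]

end Poly

end PolyTime

/-! ### Folding over lists -/

namespace PolyTime

open Prog

section FoldLoop

variable {β σ : Type} [Enc β] [Enc σ]

/-- One step of a fold by the program `q`, after the state has been moved to `aux`, given the next
symbol of the list. -/
def foldStep (q : Prog Alph) : Option Bool → Prog Alph
  | some true =>
    seq (unload false true false) (seq (push (.tree false) true) (seq q (push .cnt true)))
  | _ => unload false true false

/-- With a state and a list on the work stack and a mark on `cnt`, run `q` on the state and each
entry of the list. The state has to be moved away to see whether the list is exhausted. -/
def foldLoop (q : Prog Alph) : Prog Alph :=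
  loop .cnt fun _ => seq (grab false) (cond (.tree false) (foldStep q))

theorem run_unload_code (x : σ) (m v : List Bool) :
    Run (unload false true false) (contents false m v (code x).reverse [] [])
      (conf (code x ++ m) v) (3 * size x + 1) := by
  simpa [size] using run_unload false true false (code x).reverse (m := m) (s := v) (c := [])
    (i := [])

theorem run_foldLoop {F : σ → β → σ} {q : Prog Alph} {D T : ℕ} (l : List β) (x : σ)
    (r v : List Bool)
    (hq : ∀ y, size y ≤ D → ∀ b ∈ l, ∀ r,
      Run q (conf (code (y, b) ++ r) v) (conf (code (F y b) ++ r) v) T)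
    (hD : ∀ l₁, l₁ <+: l → size (l₁.foldl F x) ≤ D) :
    Run (foldLoop q) (contents false (code x ++ (code l ++ r)) v [] [true] [])
      (conf (code (l.foldl F x) ++ r) v) ((l.length + 1) * (8 * D + T + 12)) := by
  induction l generalizing x with
  | nil =>
    have hx : size x ≤ D := hD [] List.nil_prefix
    have hbody := (run_grab false (Enc.tree x) (m := code ([] : List β) ++ r) (s := v) (a := [])
      (i := [])).seq (run_cond_tree (b := false) (P := foldStep q)
        (by simpa [code] using! run_unload_code x r v))
    refine (run_loop_cnt hbody (.loop_nil _ rfl)).mono ?_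
    simp only [List.length_nil, size, code] at hx ⊢
    omega
  | cons b l ih =>
    have hx : size x ≤ D := hD [] List.nil_prefix
    have hrest := ih (F x b) (fun y hy c hc => hq y hy c (List.mem_cons_of_mem _ hc))
      fun l₁ hl₁ => hD (b :: l₁) (by simpa using hl₁)
    have hvalue := hq x hx b List.mem_cons_self (code l ++ r)
    simp only [code_pair, List.cons_append, List.append_assoc] at hvalue
    have hstep := (run_unload_code x (code b ++ (code l ++ r)) v).seq
      ((run_push_tree false true).seq (hvalue.seq (run_push_cnt true)))
    have hbody := (run_grab false (Enc.tree x) (m := true :: (code b ++ (code l ++ r))) (s := v)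
      (a := []) (i := [])).seq (run_cond_tree (b := true) (P := foldStep q)
        (by simpa [code] using! hstep))
    rw [code_cons, List.cons_append, List.append_assoc]
    refine (run_loop_cnt hbody hrest).mono ?_
    simp only [List.length_cons, size, code] at hx ⊢
    rw [add_mul (l.length + 1)]
    omega

theorem polyRun_foldLoop {ι : Type} {μ D : ι → ℕ} {f : ι → List β} {g : ι → σ} {F : σ → β → σ}
    {q : Prog Alph} (hq : Computes q fun x : σ × β => F x.1 x.2)
    (hf : PolyBdd μ fun i => size (f i)) (hD : PolyBdd μ D)
    (hbound : ∀ i l, l <+: f i → size (l.foldl F (g i)) ≤ D i) (r v : ι → List Bool) :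
    PolyRun μ (seq (push .cnt true) (foldLoop q))
      (fun i => conf (code (g i) ++ (code (f i) ++ r i)) (v i))
      fun i => conf (code ((f i).foldl F (g i)) ++ r i) (v i) := by
  obtain ⟨t, ⟨P, hP⟩, hq⟩ := hq
  have hT : PolyBdd μ fun i => P.eval (D i + size (f i) + 1) :=
    PolyBdd.trans ⟨P, fun _ => le_rfl⟩ ((hD.add hf).add (.const 1))
  refine ⟨_, (PolyBdd.const 1).add ((hf.add (.const 1)).mul
    ((((PolyBdd.const 8).mul hD).add hT).add (.const 12))), fun i => (run_push_cnt true).seq ?_⟩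
  have hloop := run_foldLoop (f i) (g i) (r i) (v i) (T := P.eval (D i + size (f i) + 1))
    (fun y hy b hb r => (hq ((y, b), r, v i)).mono ((hP _).trans (eval_monotone P ?_)))
    (hbound i)
  · refine hloop.mono (Nat.mul_le_mul_right _ ?_)
    exact Nat.add_le_add_right (length_le_size _) 1
  · have := size_le_of_mem hb
    dsimp only
    rw [size_pair]
    omega

end FoldLoop

namespace Poly

variable {α β σ : Type} [Enc α] [Enc β] [Enc σ] {f : α → List β} {g : α → σ} {D : α → ℕ}

theorem foldl_step_of_size_le {F : σ → β → σ} (hf : Poly f) (hg : Poly g)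
    (hF : Poly fun x : σ × β => F x.1 x.2) (hD : PolyBdd size D)
    (hbound : ∀ a l, l <+: f a → size (l.foldl F (g a)) ≤ D a) :
    Poly fun a => (f a).foldl F (g a) := by
  obtain ⟨-, p, hp⟩ := hg.pair hf
  obtain ⟨-, q, hq⟩ := hF
  refine ⟨hD.mono fun a => hbound a _ List.prefix_rfl, .seq p (.cond (.tree false) fun _ =>
    .seq (.push .cnt true) (foldLoop q)), PolyRun.seq hp (PolyRun.congr (.cond (b := true)
      (polyRun_foldLoop hq hf.1.ctx hD.ctx (fun x => hbound x.1) (fun x => x.2.1) fun x => x.2.2))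
      (fun x => ?_) fun _ => rfl)⟩
  rw [code_pair, List.cons_append, List.append_assoc]

theorem foldl_of_size_le {h : α → σ → β → σ} (hf : Poly f) (hg : Poly g)
    (hh : Poly fun x : α × σ × β => h x.1 x.2.1 x.2.2) (hD : PolyBdd size D)
    (hbound : ∀ a l, l <+: f a → size (l.foldl (h a) (g a)) ≤ D a) :
    Poly fun a => (f a).foldl (h a) (g a) := by
  have hfold (a : α) (l : List β) (x : σ) :
      l.foldl (fun y b => (y.1, h y.1 y.2 b)) (a, x) = (a, l.foldl (h a) x) := by
    induction l generalizing x with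
    | nil => rfl
    | cons b _ ih => exact ih _
  have hstep : Poly fun x : (α × σ) × β => (x.1.1, h x.1.1 x.1.2 x.2) :=
    .pair (by fun_prop) (hh.comp (f := fun x : (α × σ) × β => (x.1.1, x.1.2, x.2)) (by fun_prop))
  have hpair := foldl_step_of_size_le hf (.pair .id hg)
    (F := fun (y : α × σ) b => (y.1, h y.1 y.2 b)) hstep
    (((PolyBdd.refl size).add hD).add (.const 1)) fun a l hl => by
      have := hbound a l hl
      rw [hfold, size_pair]
      omega
  simpa only [hfold] using hpair.snd

theorem foldl {h : α → σ → β → σ} (hf : Poly f) (hg : Poly g)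
    (hh : Poly fun x : α × σ × β => h x.1 x.2.1 x.2.2) (hD : PolyBdd size D)
    (hbound : ∀ a x, ∀ b ∈ f a, size (h a x b) ≤ size x + D a) :
    Poly fun a => (f a).foldl (h a) (g a) := by
  refine foldl_of_size_le hf hg hh (D := fun a => size (g a) + size (f a) * D a)
    (hg.1.add (hf.1.mul hD)) fun a l hl => ?_
  have hgrowth (l : List β) (x : σ) (hl : ∀ b ∈ l, b ∈ f a) :
      size (l.foldl (h a) x) ≤ size x + l.length * D a := by
    induction l generalizing x with
    | nil => simp
    | cons b l ih =>
      have hrest := ih (h a x b) fun c hc => hl c (List.mem_cons_of_mem _ hc)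
      have hfirst := hbound a x b (hl b List.mem_cons_self)
      simp only [List.foldl_cons, List.length_cons, add_mul]
      omega
  refine (hgrowth l _ fun b hb => hl.subset hb).trans (Nat.add_le_add_left ?_ _)
  exact Nat.mul_le_mul_right _ (hl.length_le.trans (length_le_size _))

end Poly

end PolyTime

/-! ### Operations on lists and truth values -/

namespace PolyTime

section

variable {α β γ σ : Type} [Enc α] [Enc β] [Enc γ] [Enc σ]

theorem size_le_of_forall_mem {l : List α} {c : ℕ} (h : ∀ a ∈ l, size a ≤ c) :
    size l ≤ l.length * (c + 1) + 1 := by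
  induction l with
  | nil => simp
  | cons a l ih =>
    have hl := ih fun b hb => h b (List.mem_cons_of_mem _ hb)
    have ha := h a List.mem_cons_self
    simp only [size_cons, List.length_cons, add_mul]
    omega

theorem size_le_of_suffix {l l' : List α} (h : l <:+ l') : size l ≤ size l' := by
  obtain ⟨t, rfl⟩ := h
  have := size_append t l
  have := one_le_size t
  omega

theorem PolyBdd.of_mem {t : α × β → ℕ} {f : α → List β} (ht : PolyBdd size t) (hf : Poly f) :
    ∃ D : α → ℕ, PolyBdd size D ∧ ∀ a, ∀ b ∈ f a, t (a, b) ≤ D a := by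
  obtain ⟨P, hP⟩ := ht
  have hD : PolyBdd size fun a => P.eval (size a + size (f a) + 1) :=
    PolyBdd.trans ⟨P, fun _ => le_rfl⟩ (((PolyBdd.refl size).add hf.1).add (.const 1))
  refine ⟨_, hD, fun a b hb => (hP _).trans (eval_monotone P ?_)⟩
  have := size_le_of_mem hb
  rw [size_pair]
  omega

namespace Poly

variable {f : α → List β}

@[fun_prop] theorem cons {g : α → β} (hg : Poly g) (hf : Poly f) : Poly fun a => g a :: f a :=
  (Poly.pair hg hf).of_tree_eq fun _ => rfl

@[fun_prop] theorem tail (hf : Poly f) : Poly fun a => (f a).tail :=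
  (hf.list_cases (g := fun _ => []) (h := fun _ _ l => l) (by fun_prop) (by fun_prop)).of_eq
    fun a => by cases f a <;> rfl

@[fun_prop] theorem headD {g : α → β} (hf : Poly f) (hg : Poly g) :
    Poly fun a => (f a).headD (g a) :=
  (hf.list_cases (h := fun _ b _ => b) hg (by fun_prop)).of_eq fun a => by cases f a <;> rfl

@[fun_prop] theorem isEmpty (hf : Poly f) : Poly fun a => (f a).isEmpty :=
  (hf.list_cases (g := fun _ => true) (h := fun _ _ _ => false) (.const _) (.const _)).of_eq
    fun a => by cases f a <;> rfl

section Bool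

variable {b c : α → Bool}

@[fun_prop] theorem and (hb : Poly b) (hc : Poly c) : Poly fun a => b a && c a :=
  (hb.ite hc (.const false)).of_eq fun a => by cases b a <;> rfl

@[fun_prop] theorem or (hb : Poly b) (hc : Poly c) : Poly fun a => b a || c a :=
  (hb.ite (.const true) hc).of_eq fun a => by cases b a <;> rfl

@[fun_prop] theorem not (hb : Poly b) : Poly fun a => !b a :=
  (hb.ite (.const false) (.const true)).of_eq fun a => by cases b a <;> rfl

end Bool

@[fun_prop] theorem reverse (hf : Poly f) : Poly fun a => (f a).reverse := by
  refine (hf.foldl (g := fun _ => []) (h := fun _ l b => b :: l) (.const _) (by fun_prop)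
    (hf.1.add (.const 1)) fun a x b hb => ?_).of_eq fun a => by simp
  have := size_le_of_mem hb
  rw [size_cons]
  omega

theorem foldr_of_size_le {g : α → σ} {h : α → β → σ → σ} {D : α → ℕ} (hf : Poly f) (hg : Poly g)
    (hh : Poly fun x : α × β × σ => h x.1 x.2.1 x.2.2) (hD : PolyBdd size D)
    (hbound : ∀ a l, l <:+ f a → size (l.foldr (h a) (g a)) ≤ D a) :
    Poly fun a => (f a).foldr (h a) (g a) := by
  refine (hf.reverse.foldl_of_size_le (h := fun a x b => h a b x) hg
    (hh.comp (f := fun x : α × σ × β => (x.1, x.2.2, x.2.1)) (by fun_prop)) hD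
    fun a l hl => ?_).of_eq fun a => List.foldl_reverse
  rw [← List.foldr_reverse]
  exact hbound a _ (by simpa using List.reverse_suffix.2 hl)

theorem foldr {g : α → σ} {h : α → β → σ → σ} {D : α → ℕ} (hf : Poly f) (hg : Poly g)
    (hh : Poly fun x : α × β × σ => h x.1 x.2.1 x.2.2) (hD : PolyBdd size D)
    (hbound : ∀ a x, ∀ b ∈ f a, size (h a b x) ≤ size x + D a) :
    Poly fun a => (f a).foldr (h a) (g a) :=
  (hf.reverse.foldl (h := fun a x b => h a b x) hg
    (hh.comp (f := fun x : α × σ × β => (x.1, x.2.2, x.2.1)) (by fun_prop)) hD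
    fun a x b hb => hbound a x b (List.mem_reverse.1 hb)).of_eq fun a => List.foldl_reverse

@[fun_prop] theorem append {g : α → List β} (hf : Poly f) (hg : Poly g) :
    Poly fun a => f a ++ g a := by
  refine (hf.foldr (h := fun _ b l => b :: l) hg (by fun_prop) (hf.1.add (.const 1))
    fun a x b hb => ?_).of_eq fun a => by simp
  have := size_le_of_mem hb
  rw [size_cons]
  omega

@[fun_prop] theorem flatMap {h : α → β → List γ} (hf : Poly f)
    (hh : Poly fun x : α × β => h x.1 x.2) : Poly fun a => (f a).flatMap fun b => h a b := by
  obtain ⟨D, hD, hbound⟩ := hh.1.of_mem hf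
  have hstep : Poly fun x : α × β × List γ => h x.1 x.2.1 ++ x.2.2 :=
    .append (hh.comp (f := fun x : α × β × List γ => (x.1, x.2.1)) (by fun_prop)) (by fun_prop)
  refine (hf.foldr (g := fun _ => []) (h := fun a b l => h a b ++ l) (.const _) hstep hD
    fun a x b hb => ?_).of_eq fun a => ?_
  · have hsize := size_append (h a b) x
    have hb' := hbound a b hb
    dsimp only at hb'
    omega
  · induction f a with
    | nil => rfl
    | cons b l ih => simp [ih]

@[fun_prop] theorem map {h : α → β → γ} (hf : Poly f) (hh : Poly fun x : α × β => h x.1 x.2) :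
    Poly fun a => (f a).map fun b => h a b :=
  (hf.flatMap (h := fun a b => [h a b]) (by fun_prop)).of_eq fun _ => List.map_eq_flatMap.symm

@[fun_prop] theorem flatten {f : α → List (List β)} (hf : Poly f) : Poly fun a => (f a).flatten :=
  (hf.flatMap (h := fun _ b => b) (by fun_prop)).of_eq fun _ => by simp [List.flatMap_id']

section Predicates

variable {h : α → β → Bool} (hf : Poly f) (hh : Poly fun x : α × β => h x.1 x.2)
include hf hh

@[fun_prop] theorem filter : Poly fun a => (f a).filter fun b => h a b := by
  refine (hf.flatMap (h := fun a b => if h a b then [b] else []) (by fun_prop)).of_eq fun a => ?_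
  induction f a with
  | nil => rfl
  | cons b l ih =>
    rw [List.filter_cons, List.flatMap_cons, ih]
    split_ifs <;> rfl

@[fun_prop] theorem all : Poly fun a => (f a).all fun b => h a b :=
  (hf.filter (h := fun a b => !h a b) (by fun_prop)).isEmpty.of_eq fun a => by
    rw [Bool.eq_iff_iff]
    simp

@[fun_prop] theorem any : Poly fun a => (f a).any fun b => h a b :=
  (hf.all (h := fun a b => !h a b) (by fun_prop)).not.of_eq fun a => by
    rw [Bool.eq_iff_iff]
    simp

@[fun_prop] theorem takeWhile : Poly fun a => (f a).takeWhile fun b => h a b := by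
  have hstep : Poly fun x : α × β × List β => if h x.1 x.2.1 then x.2.1 :: x.2.2 else [] :=
    .ite (hh.comp (f := fun x : α × β × List β => (x.1, x.2.1)) (by fun_prop)) (by fun_prop)
      (.const _)
  refine (hf.foldr (g := fun _ => []) (h := fun a b l => if h a b then b :: l else []) (.const _)
    hstep (hf.1.add (.const 1)) fun a x b hb => ?_).of_eq fun a => ?_
  · have := size_le_of_mem hb
    split_ifs <;> simp only [size_cons, size_nil] <;> omega
  · induction f a with
    | nil => rfl
    | cons b l ih => rw [List.takeWhile_cons, List.foldr_cons, ih]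

@[fun_prop] theorem dropWhile : Poly fun a => (f a).dropWhile fun b => h a b := by
  refine ((hf.takeWhile hh).foldl hf (h := fun _ l _ => l.tail) (by fun_prop) (.const 0)
    fun a l b _ => size_le_of_suffix l.tail_suffix).of_eq fun a => ?_
  induction f a with
  | nil => rfl
  | cons b l ih => by_cases hb : h a b <;> simp [hb, ih]

end Predicates

@[fun_prop] theorem dropLast (hf : Poly f) : Poly fun a => (f a).dropLast :=
  hf.reverse.tail.reverse.of_eq fun a => by simp

end Poly

end

section Splits

variable {α β : Type} {l : List β} {x : List β × List β}

/-- All suffixes of a list, each with the prefix before it. -/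
def splits (l : List β) : List (List β × List β) := l.inits.zip l.tails

theorem splits_cons (b : β) (l : List β) :
    splits (b :: l) = ([], b :: l) :: (splits l).map fun x => (b :: x.1, x.2) := by
  rw [splits, List.inits_cons, List.tails_cons, List.zip_cons_cons, List.zip_map_left]
  rfl

theorem mem_splits : x ∈ splits l ↔ x.1 ++ x.2 = l := List.mem_zip_inits_tails

theorem pairwise_iff_forall_mem_splits {R : β → β → Prop} :
    l.Pairwise R ↔ ∀ x ∈ splits l, ∀ a ∈ x.1, ∀ b ∈ x.2, R a b := by
  refine ⟨fun h x hx => ?_, fun h => List.pairwise_iff_getElem.2 fun i j _ hj hij => ?_⟩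
  · rw [← mem_splits.1 hx] at h
    exact (List.pairwise_append.1 h).2.2
  · exact h (l.take j, l.drop j) (mem_splits.2 (List.take_append_drop j l)) _
      (List.mem_take_iff_getElem.2 ⟨i, by omega, rfl⟩) _
      (List.mem_drop_iff_getElem.2 ⟨0, by omega, rfl⟩)

theorem splits_eq_foldr (l : List β) : splits l = l.foldr
    (fun b s => ([], b :: (s.headD ([], [])).2) :: s.map fun x => (b :: x.1, x.2)) [([], [])] := by
  induction l with
  | nil => rfl
  | cons b l ih =>
    rw [List.foldr_cons, ← ih, splits_cons]
    cases l <;> rfl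

variable [Enc α] [Enc β]

theorem size_splits_le (l : List β) : size (splits l) ≤ (size l + 1) * (size l + 3) + 1 := by
  have hmem : ∀ x ∈ splits l, size x ≤ size l + 2 := fun x hx => by
    have := size_append x.1 x.2
    rw [mem_splits.1 hx] at this
    rw [size_pair]
    omega
  have hlength : (splits l).length = l.length + 1 := by simp [splits]
  refine (size_le_of_forall_mem hmem).trans ?_
  rw [hlength]
  gcongr
  exact length_le_size l

@[fun_prop] theorem Poly.splits {f : α → List β} (hf : Poly f) : Poly fun a => splits (f a) := by
  simp only [splits_eq_foldr]
  refine hf.foldr_of_size_le (by fun_prop) (by fun_prop)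
    (((hf.1.add (.const 1)).mul (hf.1.add (.const 3))).add (.const 1)) fun a l hl => ?_
  rw [← splits_eq_foldr]
  refine (size_splits_le l).trans ?_
  gcongr <;> exact size_le_of_suffix hl

end Splits

end PolyTime

/-! ### Equality tests -/

namespace PolyTime

section Equality

variable {α β γ : Type} [Enc α] [Enc β] [Enc γ]

/-- Equality as a truth value. -/
def eqb [DecidableEq β] (a b : β) : Bool := decide (a = b)

omit [Enc β] in
@[simp] theorem eqb_iff [DecidableEq β] {a b : β} : eqb a b = true ↔ a = b := by simp [eqb]

/-- Types with an equality test that is computable in polynomial time. -/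
class PolyEq (β : Type) [Enc β] [DecidableEq β] : Prop where
  poly : Poly fun p : β × β => eqb p.1 p.2

variable [DecidableEq β] [DecidableEq γ]

@[fun_prop] theorem Poly.eqb [PolyEq β] {f g : α → β} (hf : Poly f) (hg : Poly g) :
    Poly fun a => eqb (f a) (g a) :=
  PolyEq.poly.comp (hf.pair hg)

theorem PolyEq.of_injective [PolyEq γ] (e : β → γ) (he : Function.Injective e)
    (htree : ∀ b, Enc.tree (e b) = Enc.tree b) : PolyEq β where
  poly := by
    have hpoly : Poly e := Poly.id.of_tree_eq htree
    exact Poly.of_eq (f := fun p : β × β => PolyTime.eqb (e p.1) (e p.2)) (by fun_prop)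
      fun p => by simp [PolyTime.eqb, he.eq_iff]

instance : PolyEq Bool where
  poly := Poly.of_eq (f := fun p : Bool × Bool => if p.1 then p.2 else !p.2) (by fun_prop)
    fun p => by rcases p with ⟨_ | _, _ | _⟩ <;> rfl

/-- One step of the comparison of two lists: compare `b` with the next entry of the list in the
state. -/
def eqStep (x : List β × Bool) (b : β) : List β × Bool :=
  (x.1.tail, x.2 && !x.1.isEmpty && eqb (x.1.headD b) b)

omit [Enc β] in
theorem foldl_eqStep (l l' : List β) (c : Bool) :
    ((l'.foldl eqStep (l, c)).2 && (l'.foldl eqStep (l, c)).1.isEmpty) = (c && eqb l l') := by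
  induction l' generalizing l c with
  | nil => cases l <;> simp [eqb]
  | cons b l' ih =>
    rw [List.foldl_cons, eqStep, ih]
    rw [Bool.eq_iff_iff]
    cases l <;> simp [and_assoc]

instance [PolyEq β] : PolyEq (List β) where
  poly := by
    have hfold : Poly fun p : List β × List β => p.2.foldl eqStep (p.1, true) := by
      refine Poly.foldl (h := fun _ => eqStep) (by fun_prop) (by fun_prop)
        (by unfold eqStep; fun_prop) (.const 3) fun a x b _ => ?_
      have htail := size_le_of_suffix x.1.tail_suffix
      have hbool := size_bool_le (x.2 && !x.1.isEmpty && PolyTime.eqb (x.1.headD b) b)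
      rw [eqStep, size_pair, size_pair x.1]
      omega
    exact (hfold.snd.and hfold.fst.isEmpty).of_eq fun p => by simp [foldl_eqStep]

end Equality

/-! ### Natural numbers in binary -/

instance : Enc ℕ where
  tree n := Enc.tree n.bits

/-- The number with the given binary digits, least significant digit first. -/
def ofBits (l : List Bool) : ℕ := l.foldr Nat.bit 0

@[simp] theorem ofBits_nil : ofBits [] = 0 := rfl

@[simp] theorem ofBits_cons (b : Bool) (l : List Bool) :
    ofBits (b :: l) = Nat.bit b (ofBits l) := rfl

theorem ofBits_eq_tail (l : List Bool) : ofBits l = 2 * ofBits l.tail + (l.headD false).toNat := by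
  cases l with
  | nil => rfl
  | cons b l => rw [ofBits_cons, Nat.bit_val, List.tail_cons, List.headD_cons]

theorem ofBits_lt (l : List Bool) : ofBits l < 2 ^ l.length := by
  induction l with
  | nil => simp
  | cons b l ih =>
    rw [ofBits_cons, Nat.bit_val, List.length_cons, pow_succ]
    have := Bool.toNat_le b
    omega

@[simp] theorem ofBits_bits (n : ℕ) : ofBits n.bits = n := by
  induction n using Nat.binaryRec' with
  | zero => simp
  | bit b n h ih => rw [Nat.bits_append_bit n b h, ofBits_cons, ih]

theorem encodeNat_eq_bits (n : ℕ) : Computability.encodeNat n = n.bits := by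
  have hpos (m : PosNum) : Computability.encodePosNum m = (m : ℕ).bits := by
    induction m with
    | one => simp [Computability.encodePosNum]
    | bit0 m ih =>
      rw [Computability.encodePosNum, ih, PosNum.cast_bit0, ← two_mul,
        Nat.bit0_bits _ (PosNum.cast_pos m).ne']
    | bit1 m ih => rw [Computability.encodePosNum, ih, PosNum.cast_bit1, ← two_mul, Nat.bit1_bits]
  have hnum (m : Num) : Computability.encodeNum m = (m : ℕ).bits := by
    cases m with
    | zero => exact Nat.zero_bits.symm
    | pos m => exact hpos m
  rw [Computability.encodeNat, hnum, Num.to_of_nat]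

theorem bits_ofBits (l : List Bool) :
    (ofBits l).bits = l.foldr (fun b m => if b || !m.isEmpty then b :: m else []) [] := by
  induction l with
  | nil => simp
  | cons b l ih =>
    rw [List.foldr_cons, ← ih, ofBits_cons]
    rcases Nat.eq_zero_or_pos (ofBits l) with h | h
    · cases b <;> simp [h]
    · have hne : (ofBits l).bits ≠ [] := fun hnil => by
        rw [← ofBits_bits (ofBits l), hnil] at h
        exact h.false
      rw [Nat.bits_append_bit _ _ fun hl => absurd hl h.ne', if_pos (by simp [hne])]

instance : PolyEq ℕ :=
  .of_injective Nat.bits (Function.LeftInverse.injective ofBits_bits) fun _ => rfl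

theorem lt_two_pow_length_bits (n : ℕ) : n < 2 ^ n.bits.length := by
  rw [Nat.size_eq_bits_len]
  exact Nat.lt_size_self n

theorem size_nat_le (n : ℕ) : size n ≤ n.bits.length * 4 + 1 :=
  size_le_of_forall_mem (l := n.bits) fun b _ => size_bool_le b

theorem size_ofBits_le (l : List Bool) : size (ofBits l) ≤ l.length * 4 + 1 := by
  have hlength : (ofBits l).bits.length ≤ l.length := by
    rw [Nat.size_eq_bits_len]
    exact Nat.size_le.2 (ofBits_lt l)
  have := size_nat_le (ofBits l)
  omega

theorem add_lt_two_pow {m n i j : ℕ} (hm : m < 2 ^ i) (hn : n < 2 ^ j) :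
    m + n < 2 ^ (i + j + 1) := by
  have hi : 2 ^ i ≤ 2 ^ (i + j) := Nat.pow_le_pow_right two_pos (by omega)
  have hj : 2 ^ j ≤ 2 ^ (i + j) := Nat.pow_le_pow_right two_pos (by omega)
  rw [pow_succ]
  omega

theorem length_bits_sum_le (l : List ℕ) : l.sum.bits.length ≤ size l := by
  induction l with
  | nil => simp
  | cons n l ih =>
    have hn : n.bits.length ≤ size n := length_le_size n.bits
    have hsum : (n + l.sum).bits.length ≤ n.bits.length + l.sum.bits.length + 1 := by
      rw [Nat.size_eq_bits_len (n + l.sum)]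
      exact Nat.size_le.2 (add_lt_two_pow (lt_two_pow_length_bits n) (lt_two_pow_length_bits l.sum))
    rw [List.sum_cons, size_cons]
    omega

/-- One step of the addition of two numbers: the state consists of the remaining digits, the carry
and the digits of the sum so far, most significant digit first. -/
def addStep (x : (List Bool × List Bool) × Bool × List Bool) :
    (List Bool × List Bool) × Bool × List Bool :=
  ((x.1.1.tail, x.1.2.tail),
    if x.1.1.headD false then x.1.2.headD false || x.2.1 else x.1.2.headD false && x.2.1,
    eqb (x.1.1.headD false) (eqb (x.1.2.headD false) x.2.1) :: x.2.2)

theorem foldl_addStep (k x y : List Bool) (c : Bool) (z : List Bool)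
    (h : ofBits x + ofBits y + c.toNat < 2 ^ k.length) :
    ∃ o, (k.foldl (fun s _ => addStep s) ((x, y), c, z)).2.2 = o.reverse ++ z ∧
      ofBits o = ofBits x + ofBits y + c.toNat := by
  induction k generalizing x y c z with
  | nil =>
    rw [List.length_nil, pow_zero, Nat.lt_one_iff] at h
    exact ⟨[], rfl, h.symm⟩
  | cons b k ih =>
    rw [List.length_cons, pow_succ, ofBits_eq_tail x, ofBits_eq_tail y] at h
    rw [List.foldl_cons, addStep, ofBits_eq_tail x, ofBits_eq_tail y]
    dsimp only
    generalize x.headD false = u at h ⊢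
    generalize y.headD false = v at h ⊢
    obtain ⟨o, ho, hsum⟩ := ih x.tail y.tail (if u then v || c else v && c) (eqb u (eqb v c) :: z)
      (by cases u <;> cases v <;> cases c <;> simp at h ⊢ <;> omega)
    refine ⟨eqb u (eqb v c) :: o, by simp [ho], ?_⟩
    rw [ofBits_cons, hsum, Nat.bit_val]
    cases u <;> cases v <;> cases c <;> simp [eqb] <;> omega

/-- One step of the comparison of two numbers: the state consists of the remaining digits and the
result of the comparison so far. -/
def ltStep (x : (List Bool × List Bool) × Bool) : (List Bool × List Bool) × Bool :=
  ((x.1.1.tail, x.1.2.tail),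
    if eqb (x.1.1.headD false) (x.1.2.headD false) then x.2 else x.1.2.headD false)

theorem foldl_ltStep (k x y : List Bool) (c : Bool) (hx : ofBits x < 2 ^ k.length)
    (hy : ofBits y < 2 ^ k.length) :
    (k.foldl (fun s _ => ltStep s) ((x, y), c)).2 = true ↔
      ofBits x < ofBits y ∨ ofBits x = ofBits y ∧ c = true := by
  induction k generalizing x y c with
  | nil =>
    rw [List.length_nil, pow_zero, Nat.lt_one_iff] at hx hy
    simp [hx, hy]
  | cons b k ih =>
    rw [List.length_cons, pow_succ] at hx hy
    rw [ofBits_eq_tail] at hx hy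
    rw [List.foldl_cons, ltStep, ih _ _ _ (by dsimp only; omega) (by dsimp only; omega),
      ofBits_eq_tail x, ofBits_eq_tail y]
    dsimp only
    generalize x.headD false = u
    generalize y.headD false = v
    cases u <;> cases v <;> cases c <;> simp [eqb] <;> omega

/-- The order of natural numbers as a truth value. -/
def ltb (m n : ℕ) : Bool := decide (m < n)

@[simp] theorem ltb_iff {m n : ℕ} : ltb m n = true ↔ m < n := by simp [ltb]

namespace Poly

variable {α : Type} [Enc α] {f g : α → ℕ}

@[fun_prop] theorem bits (hf : Poly f) : Poly fun a => (f a).bits := hf.of_tree_eq fun _ => rfl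

@[fun_prop] theorem ofBits {f : α → List Bool} (hf : Poly f) : Poly fun a => ofBits (f a) := by
  have hbits := hf.foldr (g := fun _ => ([] : List Bool))
    (h := fun _ b m => if b || !m.isEmpty then b :: m else []) (.const _) (by fun_prop)
    (.const 4) fun a m b _ => by
      have := size_bool_le b
      split_ifs <;> simp only [size_cons, size_nil] <;> omega
  refine hbits.of_tree_eq fun a => ?_
  rw [← bits_ofBits]
  rfl

@[fun_prop] theorem add (hf : Poly f) (hg : Poly g) : Poly fun a => f a + g a := by
  have hfold : Poly fun a => (true :: ((f a).bits ++ (g a).bits)).foldl (fun s _ => addStep s)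
      (((f a).bits, (g a).bits), false, []) := by
    refine Poly.foldl (h := fun _ s _ => addStep s) (by fun_prop) (by fun_prop)
      (by unfold addStep; fun_prop) (.const 7) fun a x b _ => ?_
    rcases x with ⟨⟨x, y⟩, c, z⟩
    have hx := size_le_of_suffix x.tail_suffix
    have hy := size_le_of_suffix y.tail_suffix
    have hcarry := size_bool_le (if x.headD false then y.headD false || c else y.headD false && c)
    have hdigit := size_bool_le (PolyTime.eqb (x.headD false) (PolyTime.eqb (y.headD false) c))
    simp only [size_pair, addStep, size_cons]
    omega
  refine hfold.snd.snd.reverse.ofBits.of_eq fun a => ?_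
  have hlt := add_lt_two_pow (lt_two_pow_length_bits (f a)) (lt_two_pow_length_bits (g a))
  obtain ⟨o, ho, hsum⟩ := foldl_addStep (true :: ((f a).bits ++ (g a).bits)) (f a).bits (g a).bits
    false [] (by simpa using hlt)
  simp only [ho, hsum, List.append_nil, List.reverse_reverse, ofBits_bits, Bool.toNat_false,
    add_zero]

@[fun_prop] theorem ltb (hf : Poly f) (hg : Poly g) : Poly fun a => ltb (f a) (g a) := by
  have hfold : Poly fun a => ((f a).bits ++ (g a).bits).foldl (fun s _ => ltStep s)
      (((f a).bits, (g a).bits), false) := by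
    refine Poly.foldl (h := fun _ s _ => ltStep s) (by fun_prop) (by fun_prop)
      (by unfold ltStep; fun_prop) (.const 3) fun a x b _ => ?_
    rcases x with ⟨⟨x, y⟩, c⟩
    have hx := size_le_of_suffix x.tail_suffix
    have hy := size_le_of_suffix y.tail_suffix
    have hresult := size_bool_le
      (if PolyTime.eqb (x.headD false) (y.headD false) then c else y.headD false)
    simp only [size_pair, ltStep]
    omega
  refine hfold.snd.of_eq fun a => ?_
  have hlt {n k : ℕ} (hk : n.bits.length ≤ k) : PolyTime.ofBits n.bits < 2 ^ k :=
    (ofBits_lt _).trans_le (Nat.pow_le_pow_right two_pos hk)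
  rw [Bool.eq_iff_iff, foldl_ltStep _ _ _ _ (hlt (by simp)) (hlt (by simp))]
  simp

@[fun_prop] theorem sum {f : α → List ℕ} (hf : Poly f) : Poly fun a => (f a).sum := by
  refine Poly.foldr_of_size_le (h := fun _ m n => m + n) hf (.const 0) (by fun_prop)
    ((hf.1.mul (.const 4)).add (.const 1)) fun a l hl => ?_
  have hbits : l.sum.bits.length * 4 + 1 ≤ size (f a) * 4 + 1 := by
    gcongr
    exact (length_bits_sum_le l).trans (size_le_of_suffix hl)
  exact (size_nat_le l.sum).trans hbits

end Poly

end PolyTime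

/-! ### Languages in P -/

namespace PolyTime

open Prog

/-- A code of fixed length for the symbols; the first bit marks binary digits. -/
def symbolBits : TiedVoting.Symbol → List Bool
  | .blank => [false, false, false]
  | .bit b => [true, b, false]
  | .bra => [false, false, true]
  | .ket => [false, true, false]
  | .comma => [false, true, true]

theorem symbolBits_injective : Function.Injective symbolBits := by
  intro x y h
  revert x y
  decide

instance : Enc TiedVoting.Symbol where
  tree x := Enc.tree (symbolBits x)

instance : PolyEq TiedVoting.Symbol := .of_injective symbolBits symbolBits_injective fun _ => rfl

theorem size_symbol_le (x : TiedVoting.Symbol) : size x ≤ 13 := by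
  rcases x with _ | ⟨_ | _⟩ | _ | _ | _ <;> decide

theorem size_word_le (w : List TiedVoting.Symbol) : size w ≤ 14 * w.length + 1 := by
  have := size_le_of_forall_mem (l := w) fun x _ => size_symbol_le x
  omega

/-- The digit carried by a symbol. -/
def digit (x : TiedVoting.Symbol) : Bool := (symbolBits x).tail.headD false

/-- Whether a symbol carries a digit. -/
def isDigit (x : TiedVoting.Symbol) : Bool := (symbolBits x).headD false

namespace Poly

variable {α : Type} [Enc α] {f : α → TiedVoting.Symbol}

theorem symbolBits (hf : Poly f) : Poly fun a => symbolBits (f a) := hf.of_tree_eq fun _ => rfl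

@[fun_prop] theorem digit (hf : Poly f) : Poly fun a => digit (f a) :=
  hf.symbolBits.tail.headD (.const false)

@[fun_prop] theorem isDigit (hf : Poly f) : Poly fun a => isDigit (f a) :=
  hf.symbolBits.headD (.const false)

@[fun_prop] theorem bit {f : α → Bool} (hf : Poly f) :
    Poly fun a => (.bit (f a) : TiedVoting.Symbol) :=
  Poly.of_tree_eq (f := fun a => [true, f a, false]) (by fun_prop) fun _ => rfl

end Poly

/-- Write the code of the input on the work stack. -/
def load : Prog Alph :=
  seq (push (.tree false) false)
    (seq (loop .inp fun x : TiedVoting.Symbol => pushWord .aux (true :: code x).reverse)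
      (unload false true false))

theorem run_loop_load (w : List TiedVoting.Symbol) {m s a c} :
    Run (loop .inp fun x : TiedVoting.Symbol => pushWord .aux (true :: code x).reverse)
      (contents false m s a c w)
      (contents false m s ((w.flatMap fun x => true :: code x).reverse ++ a) c [])
      (3 * size w) := by
  induction w generalizing a with
  | nil => exact .mono (.loop_nil _ rfl) (by simp)
  | cons x w ih =>
    have hpush := run_pushWord (Γ := Alph) (k := .aux) (true :: code x).reverse
      (contents false m s a c w)
    rw [update_contents_aux] at hpush
    have hrun := run_loop_inp hpush ih
    rw [← List.append_assoc, ← List.reverse_append] at hrun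
    refine hrun.mono ?_
    rw [List.length_reverse, List.length_cons, size_cons, size, size]
    omega

theorem run_load (w : List TiedVoting.Symbol) :
    Run load (contents false [] [] [] [] w) (conf (code w) []) (6 * size w + 2) := by
  have hunload := run_unload false true false (w.flatMap fun x => true :: code x).reverse
    (m := [false]) (s := []) (c := []) (i := [])
  have hsize : size w = (w.flatMap fun x => true :: code x).length + 1 := by
    rw [size, code_list, List.length_append, List.length_singleton]
  rw [List.reverse_reverse, if_pos rfl, ← code_list, List.length_reverse] at hunload
  have hloop := run_loop_load w (m := [false]) (s := []) (a := []) (c := [])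
  rw [List.append_nil] at hloop
  exact ((run_push_tree false false).seq (hloop.seq hunload)).mono (by omega)

/-- Replace the code of a truth value on the work stack by the word that consists of this value. -/
def report : Prog Alph :=
  cond (.tree false) fun
    | some true => cond (.tree false) fun _ => cond (.tree false) fun _ => push (.tree false) true
    | _ => push (.tree false) false

theorem run_report (b : Bool) : Run report (conf (code b) []) (conf [b] []) 4 := by
  cases b
  · exact (run_cond_tree (run_push_tree false false)).mono (by omega)
  · exact run_cond_tree (run_cond_tree (run_cond_tree (run_push_tree false true)))

theorem contents_eq_update_inp (w : List TiedVoting.Symbol) :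
    contents false [] [] [] [] w = Function.update (β := fun k => List (Alph k)) (fun _ => [])
      .inp w := by
  funext k
  rcases k with k | _ | _ | _ <;> try rfl
  cases k <;> rfl

theorem conf_eq_update (o : List Bool) :
    conf o [] = Function.update (β := fun k => List (Alph k)) (fun _ => []) (.tree false) o := by
  funext k
  rcases k with k | _ | _ | _ <;> try rfl
  cases k <;> rfl

theorem Poly.inP {A : Set (List TiedVoting.Symbol)} {f : List TiedVoting.Symbol → Bool}
    (hf : Poly f) (h : ∀ w, f w = true ↔ w ∈ A) : TiedVoting.InP A := by
  obtain ⟨-, p, t, ⟨T, hT⟩, hp⟩ := hf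
  have hrun (w : List TiedVoting.Symbol) : Run (seq load (seq p report))
      (Function.update (fun _ => []) .inp w) (Function.update (fun _ => []) (.tree false) [f w])
      (84 * w.length + T.eval (14 * w.length + 1) + 12) := by
    have hload := run_load w
    have hcompute := hp (w, [], [])
    simp only [List.append_nil] at hcompute
    rw [← contents_eq_update_inp, ← conf_eq_update]
    refine (hload.seq (hcompute.seq (run_report (f w)))).mono ?_
    have hsize := size_word_le w
    have htime := (hT (w, [], [])).trans (eval_monotone T hsize)
    dsimp only at htime
    omega
  classical
  obtain rfl : f = fun w => decide (w ∈ A) := funext fun w => by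
    rw [Bool.eq_iff_iff, h, decide_eq_true_iff]
  refine ⟨{
    tm := (seq load (seq p report)).machine .inp (.tree false)
    inputAlphabet := Equiv.refl _
    outputAlphabet := Equiv.refl _
    time := 84 * Polynomial.X + T.comp (14 * Polynomial.X + 1) + 13
    outputsFun := fun w => Classical.choice ?_ }⟩
  convert (hrun w).outputsInTime
  exact congr (congrArg₂ (Turing.TM2OutputsInTime _) (List.map_id _)
    (congrArg some (List.map_id _))) (by simp [Polynomial.eval_comp])

end PolyTime

/-! ### Parsing instances -/

namespace PolyTime

open TiedVoting

section Parser

variable {β γ : Type}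

/-- The parser `p`, which splits off a value from the front of a word, inverts the code `e`. -/
def Parses (p : List Symbol → β × List Symbol) (e : β → List Symbol) : Prop :=
  ∀ b r, p (e b ++ r) = (b, r)

/-- Parse a number. -/
def parseNumber (w : List Symbol) : ℕ × List Symbol :=
  (ofBits ((w.takeWhile fun x => isDigit x).map fun x => digit x),
    (w.dropWhile fun x => isDigit x).tail)

theorem parses_encodeNumber : Parses parseNumber encodeNumber := by
  intro n r
  have hdigits : ∀ x ∈ (Computability.encodeNat n).map Computability.Γ'.bit, isDigit x = true := by
    simp only [List.mem_map]
    rintro _ ⟨b, -, rfl⟩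
    rfl
  rw [parseNumber, encodeNumber, List.append_assoc, List.takeWhile_append_of_pos hdigits,
    List.dropWhile_append_of_pos hdigits]
  simp [isDigit, digit, symbolBits, encodeNat_eq_bits, Function.comp_def]

/-- Parse two values. -/
def parsePair (p : List Symbol → β × List Symbol) (q : List Symbol → γ × List Symbol)
    (w : List Symbol) : (β × γ) × List Symbol :=
  (((p w).1, (q (p w).2).1), (q (p w).2).2)

theorem Parses.parsePair {p : List Symbol → β × List Symbol} {q : List Symbol → γ × List Symbol}
    {e : β → List Symbol} {e' : γ → List Symbol} (hp : Parses p e) (hq : Parses q e') :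
    Parses (parsePair p q) fun x => e x.1 ++ e' x.2 := fun x r => by
  rw [PolyTime.parsePair, List.append_assoc, hp, hq]

/-- One step in parsing a sequence: split off an entry unless the end is reached. -/
def seqStep (p : List Symbol → β × List Symbol) (x : List Symbol × List β) :
    List Symbol × List β :=
  if eqb (x.1.headD .ket) .ket then x else ((p x.1).2, (p x.1).1 :: x.2)

/-- Parse a sequence in brackets. The word itself serves as a bound for the number of entries. -/
def parseSeq (p : List Symbol → β × List Symbol) (w : List Symbol) : List β × List Symbol :=
  ((w.foldl (fun x _ => seqStep p x) (w.tail, [])).2.reverse,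
    (w.foldl (fun x _ => seqStep p x) (w.tail, [])).1.tail)

section Encode

variable {p : List Symbol → β × List Symbol} {e : β → List Symbol}
  (hket : ∀ b r t, e b ++ r ≠ Computability.Γ'.ket :: t)
include hket

theorem encode_ne_nil (b : β) : e b ≠ [] := fun h => hket b [.ket] [] (by simp [h])

theorem length_le_length_flatMap_encode (l : List β) : l.length ≤ (l.flatMap e).length := by
  induction l with
  | nil => simp
  | cons b l ih =>
    have := List.length_pos_iff.2 (encode_ne_nil hket b)
    rw [List.flatMap_cons, List.length_append, List.length_cons]
    omega

theorem seqStep_encode (hp : Parses p e) (b : β) (r : List Symbol) (l : List β) :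
    seqStep p (e b ++ r, l) = (r, b :: l) := by
  have hhead : eqb ((e b ++ r).headD .ket) .ket = false := by
    rcases h : e b ++ r with _ | ⟨x, t⟩
    · exact absurd (List.append_eq_nil_iff.1 h).1 (encode_ne_nil hket b)
    · rw [List.headD_cons, eqb, decide_eq_false_iff_not]
      rintro rfl
      exact hket b r t h
  simp only [seqStep, hhead, hp b r, Bool.false_eq_true, if_false]

theorem foldl_seqStep_encode (hp : Parses p e) (r k : List Symbol) (l acc : List β)
    (hl : l.length ≤ k.length) :
    k.foldl (fun x _ => seqStep p x) (l.flatMap e ++ .ket :: r, acc) =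
      (.ket :: r, l.reverse ++ acc) := by
  induction k generalizing l acc with
  | nil =>
    rw [List.length_nil, Nat.le_zero, List.length_eq_zero_iff] at hl
    simp [hl]
  | cons y k ih =>
    rw [List.foldl_cons]
    cases l with
    | nil => simpa [seqStep] using ih [] acc (by simp)
    | cons b l =>
      rw [List.flatMap_cons, List.append_assoc, seqStep_encode hket hp,
        ih l _ (by simpa using hl)]
      simp

theorem Parses.parseSeq (hp : Parses p e) : Parses (parseSeq p) (encodeSeq e) := by
  intro l r
  have hlength : l.length ≤ (encodeSeq e l ++ r).length := by
    have := length_le_length_flatMap_encode hket l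
    simp only [encodeSeq, List.length_append, List.length_cons, List.cons_append]
    omega
  have htail : (encodeSeq e l ++ r).tail = l.flatMap e ++ .ket :: r := by simp [encodeSeq]
  rw [PolyTime.parseSeq, htail, foldl_seqStep_encode hket hp r _ l [] hlength]
  simp

end Encode

/-- Parse an instance of the manipulation problem, as a tuple. -/
def parseInstance : List Symbol → (List ℕ × Profile × List ℕ × ℕ) × List Symbol :=
  parsePair (parseSeq parseNumber)
    (parsePair (parseSeq (parsePair parseNumber (parseSeq (parseSeq parseNumber))))
      (parsePair (parseSeq parseNumber) parseNumber))

/-- The instance with the given data. -/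
def ofTuple (x : List ℕ × Profile × List ℕ × ℕ) : CWCMInstance := ⟨x.1, x.2.1, x.2.2.1, x.2.2.2⟩

theorem parseInstance_encode (I : CWCMInstance) : ofTuple (parseInstance I.encode).1 = I := by
  have hnumbers := parses_encodeNumber.parseSeq encodeNumber_ne_ket
  have hvoter := parses_encodeNumber.parsePair (hnumbers.parseSeq (encodeSeq_ne_ket _))
  have hvoters := hvoter.parseSeq fun x r t => by
    rw [List.append_assoc]
    exact encodeNumber_ne_ket _ _ _
  have hinstance := hnumbers.parsePair (hvoters.parsePair (hnumbers.parsePair parses_encodeNumber))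
  have hparse := hinstance (I.axis, I.nonmanipulators, I.manipulators, I.preferred) []
  rw [List.append_nil] at hparse
  exact congrArg (fun y => ofTuple y.1) hparse

end Parser

section Poly

variable {α β γ : Type} [Enc α] [Enc β] [Enc γ]
  {p : List Symbol → β × List Symbol} {q : List Symbol → γ × List Symbol}

theorem seven_le_size (x : Symbol) : 7 ≤ size x := by
  rcases x with _ | ⟨_ | _⟩ | _ | _ | _ <;> decide

theorem length_mul_le_size (w : List Symbol) : w.length * 8 + 1 ≤ size w := by
  induction w with
  | nil => simp
  | cons x w ih =>
    have := seven_le_size x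
    rw [size_cons, List.length_cons]
    omega

theorem size_reverse (l : List β) : size l.reverse = size l := by
  induction l with
  | nil => rfl
  | cons b l ih =>
    have := size_append l.reverse [b]
    rw [size_cons, size_nil] at this
    rw [List.reverse_cons, size_cons]
    omega

/-- On nonempty words, the parser `p` reduces the size by at least `c`. -/
def Shrinks (c : ℕ) (p : List Symbol → β × List Symbol) : Prop :=
  ∀ w, w ≠ [] → size (p w).1 + size (p w).2 + c ≤ size w

theorem Shrinks.mono {c c' : ℕ} (h : Shrinks c p) (hc : c' ≤ c) : Shrinks c' p :=
  fun w hw => le_trans (by omega) (h w hw)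

theorem shrinks_parseNumber : Shrinks 3 parseNumber := by
  intro w hw
  let digits := w.takeWhile fun x => isDigit x
  let rest := w.dropWhile fun x => isDigit x
  have hvalue : size (parseNumber w).1 ≤ digits.length * 4 + 1 := by
    simpa only [List.length_map] using! size_ofBits_le (digits.map fun x => digit x)
  have hw' : digits ++ rest = w := List.takeWhile_append_dropWhile
  have hsize : size w + 1 = size digits + size rest := by rw [← size_append, hw']
  have hdigits := length_mul_le_size digits
  change size (parseNumber w).1 + size rest.tail + 3 ≤ size w
  rcases hrest : rest with _ | ⟨x, l⟩
  · have hpos : 0 < digits.length := by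
      rw [hrest, List.append_nil] at hw'
      rw [hw']
      exact List.length_pos_iff.2 hw
    rw [hrest, size_nil] at hsize
    rw [List.tail_nil, size_nil]
    omega
  · have := seven_le_size x
    rw [hrest, size_cons] at hsize
    rw [List.tail_cons]
    omega

theorem Shrinks.parsePair (hp : Shrinks 3 p) (hq : Shrinks 1 q)
    (hnil : size (q []).1 + size (q []).2 ≤ 2) : Shrinks 1 (parsePair p q) := by
  intro w hw
  have hpw := hp w hw
  simp only [PolyTime.parsePair, size_pair]
  by_cases hrest : (p w).2 = []
  · rw [hrest] at hpw ⊢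
    rw [size_nil] at hpw
    omega
  · have := hq _ hrest
    omega

theorem Shrinks.size_seqStep_le (hp : Shrinks 1 p) (x : List Symbol × List β) :
    size (seqStep p x) ≤ size x := by
  rw [seqStep]
  split_ifs with hend
  · exact le_rfl
  · have := hp x.1 (by rintro hnil; simp [hnil] at hend)
    rw [size_pair, size_pair x.1 x.2, size_cons]
    omega

theorem Shrinks.size_foldl_seqStep_le (hp : Shrinks 1 p) (k : List Symbol)
    (x : List Symbol × List β) : size (k.foldl (fun x _ => seqStep p x) x) ≤ size x := by
  induction k generalizing x with
  | nil => exact le_rfl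
  | cons y k ih => exact (ih _).trans (hp.size_seqStep_le x)

theorem Shrinks.parseSeq (hp : Shrinks 1 p) : Shrinks 3 (parseSeq p) := by
  intro w hw
  obtain ⟨z, t, rfl⟩ := List.exists_cons_of_ne_nil hw
  have hfold := hp.size_foldl_seqStep_le (z :: t) (t, [])
  simp only [PolyTime.parseSeq, size_reverse, List.tail_cons]
  generalize (z :: t).foldl (fun x _ => seqStep p x) (t, []) = x at *
  have htail := size_le_of_suffix x.1.tail_suffix
  have hz := seven_le_size z
  rw [size_pair, size_pair, size_nil] at hfold
  rw [size_cons]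
  omega

theorem poly_parseNumber : Poly parseNumber := by
  unfold parseNumber
  fun_prop

theorem Poly.parsePair (hp : Poly p) (hq : Poly q) : Poly (parsePair p q) := by
  have hrest : Poly fun w => q (p w).2 := hq.comp hp.snd
  exact (hp.fst.pair hrest.fst).pair hrest.snd

theorem Poly.parseSeq (hp : Poly p) (hs : Shrinks 1 p) : Poly (parseSeq p) := by
  have hfold : Poly fun w : List Symbol => w.foldl (fun x _ => seqStep p x) (w.tail, []) :=
    Poly.foldl (h := fun _ x _ => seqStep p x) .id (by fun_prop) (by unfold seqStep; fun_prop)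
      (.const 0) fun _ x _ _ => hs.size_seqStep_le x
  exact hfold.snd.reverse.pair hfold.fst.tail

theorem poly_parseInstance : Poly parseInstance := by
  have hsNumber : Shrinks 1 parseNumber := shrinks_parseNumber.mono (by omega)
  have hsGroup : Shrinks 1 (parseSeq parseNumber) := hsNumber.parseSeq.mono (by omega)
  have hsVote : Shrinks 1 (parseSeq (parseSeq parseNumber)) := hsGroup.parseSeq.mono (by omega)
  have hNumbers := poly_parseNumber.parseSeq hsNumber
  have hVoters := (poly_parseNumber.parsePair (hNumbers.parseSeq hsGroup)).parseSeq
    (shrinks_parseNumber.parsePair hsVote le_rfl)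
  exact hNumbers.parsePair (hVoters.parsePair (hNumbers.parsePair poly_parseNumber))

@[fun_prop] theorem Poly.encodeNumber {f : α → ℕ} (hf : Poly f) :
    Poly fun a => encodeNumber (f a) := by
  unfold TiedVoting.encodeNumber
  simp only [encodeNat_eq_bits]
  exact (hf.bits.map (h := fun _ b => Computability.Γ'.bit b) (by fun_prop)).append (.const _)

@[fun_prop] theorem Poly.encodeSeq {f : α → List β} {e : β → List Symbol} (hf : Poly f)
    (he : Poly e) : Poly fun a => encodeSeq e (f a) :=
  .cons (.const _) ((hf.flatMap (h := fun _ b => e b) (by fun_prop)).append (.const _))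

theorem poly_encode : Poly fun x => (ofTuple x).encode := by
  have hNumber : Poly TiedVoting.encodeNumber := .encodeNumber .id
  have hGroup : Poly (TiedVoting.encodeSeq TiedVoting.encodeNumber) := .encodeSeq .id hNumber
  have hVote : Poly encodeVote := .encodeSeq .id hGroup
  have hVoter : Poly encodeVoter := by
    unfold encodeVoter
    fun_prop
  unfold CWCMInstance.encode ofTuple
  fun_prop

end Poly

end PolyTime

/-! ### Predicates decidable in polynomial time -/

namespace PolyTime

section

variable {α β γ : Type} [Enc α] [Enc β] [Enc γ]

/-- The predicate `P` can be decided in polynomial time. -/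
def PolyPred (P : α → Prop) : Prop := ∃ b : α → Bool, Poly b ∧ ∀ a, b a = true ↔ P a

theorem PolyPred.inP {A : Set (List TiedVoting.Symbol)} :
    PolyPred (fun w => w ∈ A) → TiedVoting.InP A
  | ⟨_, hb, h⟩ => hb.inP h

theorem PolyPred.decide {P : α → Prop} [DecidablePred P] : PolyPred P → Poly fun a => decide (P a)
  | ⟨_, hb, h⟩ => hb.of_eq fun a => by rw [Bool.eq_iff_iff, h, decide_eq_true_iff]

theorem Poly.ite_of_polyPred {P : α → Prop} [DecidablePred P] {f g : α → β} (hP : PolyPred P)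
    (hf : Poly f) (hg : Poly g) : Poly fun a => if P a then f a else g a :=
  (hP.decide.ite hf hg).of_eq fun a => by simp only [decide_eq_true_eq]

namespace PolyPred

variable {P Q : α → Prop} {f : α → List β}

theorem congr (hP : PolyPred P) (h : ∀ a, P a ↔ Q a) : PolyPred Q :=
  (funext fun a => propext (h a)) ▸ hP

theorem comp {g : β → α} : PolyPred P → Poly g → PolyPred fun b => P (g b)
  | ⟨_, hb, h⟩, hg => ⟨_, hb.comp hg, fun a => h (g a)⟩

theorem true : PolyPred fun _ : α => True := ⟨fun _ => .true, .const _, by simp⟩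

theorem and : PolyPred P → PolyPred Q → PolyPred fun a => P a ∧ Q a
  | ⟨_, hb, h⟩, ⟨_, hc, h'⟩ => ⟨_, hb.and hc, fun a => by rw [Bool.and_eq_true, h, h']⟩

theorem or : PolyPred P → PolyPred Q → PolyPred fun a => P a ∨ Q a
  | ⟨_, hb, h⟩, ⟨_, hc, h'⟩ => ⟨_, hb.or hc, fun a => by rw [Bool.or_eq_true, h, h']⟩

theorem not : PolyPred P → PolyPred fun a => ¬P a
  | ⟨_, hb, h⟩ => ⟨_, hb.not, fun a => (Bool.not_eq_true' _).to_iff.trans (by simp [← h])⟩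

theorem iff (hP : PolyPred P) (hQ : PolyPred Q) : PolyPred fun a => P a ↔ Q a :=
  ((hP.and hQ).or (hP.not.and hQ.not)).congr fun _ => iff_iff_and_or_not_and_not.symm

theorem eq [DecidableEq β] [PolyEq β] {g h : α → β} (hg : Poly g) (hh : Poly h) :
    PolyPred fun a => g a = h a :=
  ⟨_, hg.eqb hh, fun _ => eqb_iff⟩

theorem lt {m n : α → ℕ} (hm : Poly m) (hn : Poly n) : PolyPred fun a => m a < n a :=
  ⟨_, hm.ltb hn, fun _ => ltb_iff⟩

theorem forall_mem {R : α → β → Prop} (hf : Poly f) :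
    (PolyPred fun x : α × β => R x.1 x.2) → PolyPred fun a => ∀ b ∈ f a, R a b
  | ⟨c, hc, h⟩ => ⟨_, hf.all (h := fun a b => c (a, b)) hc, fun a => by
      simp only [List.all_eq_true, h]⟩

theorem exists_mem {R : α → β → Prop} (hf : Poly f) :
    (PolyPred fun x : α × β => R x.1 x.2) → PolyPred fun a => ∃ b ∈ f a, R a b
  | ⟨c, hc, h⟩ => ⟨_, hf.any (h := fun a b => c (a, b)) hc, fun a => by
      simp only [List.any_eq_true, h]⟩

theorem mem [DecidableEq β] [PolyEq β] {g : α → β} (hg : Poly g) (hf : Poly f) :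
    PolyPred fun a => g a ∈ f a :=
  (exists_mem (R := fun a b => g a = b) hf (.eq (by fun_prop) (by fun_prop))).congr fun a => by
    simp

theorem exists_append_eq {R : α → List β → List β → Prop} (hf : Poly f)
    (hR : PolyPred fun x : α × List β × List β => R x.1 x.2.1 x.2.2) :
    PolyPred fun a => ∃ X Y, X ++ Y = f a ∧ R a X Y :=
  (exists_mem (R := fun a x => R a x.1 x.2) hf.splits hR).congr fun a => by
    simp only [mem_splits, Prod.exists]

theorem pairwise {R : α → β → β → Prop} (hf : Poly f)
    (hR : PolyPred fun x : α × β × β => R x.1 x.2.1 x.2.2) :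
    PolyPred fun a => (f a).Pairwise (R a) := by
  have hR' : PolyPred fun y : ((α × List β × List β) × β) × β => R y.1.1.1 y.1.2 y.2 :=
    hR.comp (g := fun y : ((α × List β × List β) × β) × β => (y.1.1.1, y.1.2, y.2)) (by fun_prop)
  exact (forall_mem hf.splits (forall_mem (by fun_prop) (forall_mem (by fun_prop) hR'))).congr
    fun _ => pairwise_iff_forall_mem_splits.symm

end PolyPred

@[fun_prop] theorem Poly.length {f : α → List β} (hf : Poly f) : Poly fun a => (f a).length :=
  (hf.map (h := fun _ _ => 1) (.const _)).sum.of_eq fun a => by simp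

theorem Poly.findIdx {f : α → List β} {h : α → β → Bool} (hf : Poly f)
    (hh : Poly fun x : α × β => h x.1 x.2) : Poly fun a => (f a).findIdx (h a) := by
  refine (hf.takeWhile (h := fun a b => !h a b) hh.not).length.of_eq fun a => ?_
  induction f a with
  | nil => rfl
  | cons b l ih =>
    rw [List.findIdx_cons, List.takeWhile_cons]
    cases h a b <;> simp [ih]

theorem Poly.count [DecidableEq β] [PolyEq β] {f : α → List β} {g : α → β} (hf : Poly f)
    (hg : Poly g) : Poly fun a => (f a).count (g a) :=
  (hf.filter (h := fun a b => PolyTime.eqb b (g a)) (by fun_prop)).length.of_eq fun a => by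
    rw [List.count_eq_length_filter]
    rfl

theorem PolyPred.perm [DecidableEq β] [PolyEq β] {f g : α → List β} (hf : Poly f) (hg : Poly g) :
    PolyPred fun a => (f a).Perm (g a) := by
  have hcount : PolyPred fun x : α × β => (f x.1).count x.2 = (g x.1).count x.2 :=
    .eq (.count (by fun_prop) (by fun_prop)) (.count (by fun_prop) (by fun_prop))
  refine (forall_mem (R := fun a b => (f a).count b = (g a).count b) (hf.append hg)
    hcount).congr fun a => ?_
  rw [List.perm_iff_count]
  refine ⟨fun h b => ?_, fun h b _ => h b⟩
  by_cases hb : b ∈ f a ++ g a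
  · exact h b hb
  · rw [List.mem_append, not_or] at hb
    rw [List.count_eq_zero_of_not_mem hb.1, List.count_eq_zero_of_not_mem hb.2]

theorem Poly.dedup [DecidableEq β] [PolyEq β] {f : α → List β} (hf : Poly f) :
    Poly fun a => (f a).dedup := by
  have hstep : Poly fun x : α × β × List β => if x.2.1 ∈ x.2.2 then x.2.2 else x.2.1 :: x.2.2 :=
    .ite_of_polyPred (.mem (by fun_prop) (by fun_prop)) (by fun_prop) (by fun_prop)
  refine (hf.foldr (g := fun _ => []) (h := fun _ b l => if b ∈ l then l else b :: l) (.const _)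
    hstep (hf.1.add (.const 1)) fun a x b hb => ?_).of_eq fun a => ?_
  · have := size_le_of_mem hb
    split_ifs
    · omega
    · rw [size_cons]
      omega
  · induction f a with
    | nil => rfl
    | cons b l ih =>
      rw [List.foldr_cons, ih]
      split_ifs with hb <;> rw [List.mem_dedup] at hb
      · rw [List.dedup_cons_of_mem hb]
      · rw [List.dedup_cons_of_notMem hb]

end

end PolyTime

/-! ### The decision procedure -/

namespace TiedVoting

section Score

/-- The Copeland score for `α = n / d`, multiplied by `d` to make it an integer. -/
def scaledScore (n d : ℕ) (C : List ℕ) (V : Profile) (a : ℕ) : ℕ :=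
  ((C.dedup.filter (· ≠ a)).map fun b => if support V b a < support V a b then d
    else if support V a b = support V b a then n else 0).sum

theorem mul_points {n d : ℕ} (hd : 0 < d) (m : ℤ) :
    d * points (n / d) m = if 0 < m then (d : ℚ) else if m = 0 then (n : ℚ) else 0 := by
  have hd' : (d : ℚ) ≠ 0 := Nat.cast_ne_zero.2 hd.ne'
  unfold points
  split_ifs
  exacts [mul_one _, mul_div_cancel₀ _ hd', mul_zero _]

theorem natCast_scaledScore {n d : ℕ} (hd : 0 < d) (C : List ℕ) (V : Profile) (a : ℕ) :
    (scaledScore n d C V a : ℚ) = d * copelandScore (n / d) C.toFinset V a := by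
  have hset : C.toFinset.erase a = (C.dedup.filter (· ≠ a)).toFinset := by
    ext b
    simp [and_comm]
  rw [copelandScore_eq_sum, hset, List.sum_toFinset _ (C.nodup_dedup.filter _),
    ← List.sum_map_mul_left, scaledScore, Nat.cast_list_sum, List.map_map]
  congr 2
  funext b
  rw [mul_points hd, margin_eq_sub]
  simp only [Function.comp_apply, sub_pos, sub_eq_zero, Nat.cast_lt, Nat.cast_inj]
  split_ifs <;> simp

theorem isCopelandWinner_iff_scaledScore_le {n d : ℕ} (hd : 0 < d) {C : List ℕ} {V : Profile}
    {p : ℕ} : IsCopelandWinner (n / d) C.toFinset V p ↔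
      p ∈ C ∧ ∀ c ∈ C, ¬scaledScore n d C V p < scaledScore n d C V c := by
  have hd' : (0 : ℚ) < d := Nat.cast_pos.2 hd
  simp only [IsCopelandWinner, List.mem_toFinset, not_lt, ← Nat.cast_le (α := ℚ),
    natCast_scaledScore hd, mul_le_mul_iff_right₀ hd']

end Score

end TiedVoting

namespace PolyTime

open TiedVoting

section

variable {α : Type} [Enc α] {L : α → List ℕ} {v : α → Vote} {V : α → Profile} {a b : α → ℕ}

theorem Poly.position (hv : Poly v) (ha : Poly a) : Poly fun x => position (v x) (a x) :=
  hv.findIdx (PolyPred.mem (by fun_prop) (by fun_prop)).decide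

theorem Poly.ballot (hL : Poly L) (ha : Poly a) : Poly fun x => ballot (L x) (a x) := by
  have hne : Poly fun x : α × ℕ => decide (x.2 ≠ a x.1) :=
    (PolyPred.not (.eq (by fun_prop) (by fun_prop))).decide
  exact .map (ha.cons ((hL.dropWhile (h := fun x c => decide (c ≠ a x)) hne).tail.append
    (hL.takeWhile (h := fun x c => decide (c ≠ a x)) hne).reverse))
    (h := fun _ c => [c]) (by fun_prop)

theorem Poly.unanimous {M : α → List ℕ} (hM : Poly M) (hv : Poly v) :
    Poly fun x => unanimous (M x) (v x) :=
  hM.map (h := fun x w => (w, v x)) (by fun_prop)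

namespace PolyPred

theorem prefers (hv : Poly v) (ha : Poly a) (hb : Poly b) :
    PolyPred fun x => Prefers (v x) (a x) (b x) :=
  .lt (hv.position ha) (hv.position hb)

theorem isWeakOrder (hL : Poly L) (hv : Poly v) : PolyPred fun x => IsWeakOrder (L x) (v x) :=
  .and (.forall_mem hv (.not (.eq (by fun_prop) (.const [])))) (.perm hv.flatten hL)

theorem orderKindAllows (k : OrderKind) (hv : Poly v) : PolyPred fun x => k.Allows (v x) := by
  cases k with
  | top => exact .forall_mem hv.dropLast (.eq (by fun_prop) (.const 1))
  | bottom => exact .forall_mem hv.tail (.eq (by fun_prop) (.const 1))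
  | weak => exact .true

theorem mostPreferred (hL : Poly L) (hv : Poly v) (ha : Poly a) :
    PolyPred fun x => MostPreferred (L x) (v x) (a x) :=
  .forall_mem hL (.not (.prefers (by fun_prop) (by fun_prop) (by fun_prop)))

theorem strictlyIncreasing (hv : Poly v) (hL : Poly L) :
    PolyPred fun x => StrictlyIncreasing (v x) (L x) :=
  .pairwise hL (.prefers (by fun_prop) (by fun_prop) (by fun_prop))

theorem strictlyDecreasing (hv : Poly v) (hL : Poly L) :
    PolyPred fun x => StrictlyDecreasing (v x) (L x) :=
  .pairwise hL (.prefers (by fun_prop) (by fun_prop) (by fun_prop))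

theorem singlePlateaued (hL : Poly L) (hv : Poly v) :
    PolyPred fun x => SinglePlateaued (L x) (v x) := by
  have hplateau : PolyPred fun y : (α × List ℕ × List ℕ) × List ℕ × List ℕ =>
      ∀ a ∈ L y.1.1, a ∈ y.2.1 ↔ MostPreferred (L y.1.1) (v y.1.1) a :=
    .forall_mem (by fun_prop) (.iff (.mem (by fun_prop) (by fun_prop))
      (.mostPreferred (by fun_prop) (by fun_prop) (by fun_prop)))
  refine (exists_append_eq (R := fun x X W => ∃ Y Z, Y ++ Z = W ∧
      (∀ a ∈ L x, a ∈ Y ↔ MostPreferred (L x) (v x) a) ∧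
        StrictlyIncreasing (v x) X ∧ StrictlyDecreasing (v x) Z) hL
    (exists_append_eq (by fun_prop) (hplateau.and (.and
      (.strictlyIncreasing (by fun_prop) (by fun_prop))
      (.strictlyDecreasing (by fun_prop) (by fun_prop)))))).congr fun x => ?_
  constructor
  · rintro ⟨X, _, hL, Y, Z, rfl, h⟩
    exact ⟨X, Y, Z, by rw [← hL, List.append_assoc], h⟩
  · rintro ⟨X, Y, Z, hL, h⟩
    exact ⟨X, Y ++ Z, by rw [hL, List.append_assoc], Y, Z, rfl, h⟩

theorem singlePeaked (hL : Poly L) (hv : Poly v) : PolyPred fun x => SinglePeaked (L x) (v x) := by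
  have hpeak : PolyPred fun y : (α × List ℕ × List ℕ) × ℕ =>
      ∀ a ∈ L y.1.1, a = y.2 ↔ MostPreferred (L y.1.1) (v y.1.1) a :=
    .forall_mem (by fun_prop) (.iff (.eq (by fun_prop) (by fun_prop))
      (.mostPreferred (by fun_prop) (by fun_prop) (by fun_prop)))
  refine (exists_append_eq (R := fun x X W => ∃ y ∈ W, y :: W.tail = W ∧
      (∀ a ∈ L x, a = y ↔ MostPreferred (L x) (v x) a) ∧
        StrictlyIncreasing (v x) X ∧ StrictlyDecreasing (v x) W.tail) hL
    (exists_mem (by fun_prop) (.and (.eq (by fun_prop) (by fun_prop)) (hpeak.and (.and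
      (.strictlyIncreasing (by fun_prop) (by fun_prop))
      (.strictlyDecreasing (by fun_prop) (by fun_prop))))))).congr fun x => ?_
  constructor
  · rintro ⟨X, W, hL, y, -, hW, h⟩
    exact ⟨X, y, W.tail, by rw [← hL, List.append_assoc, List.singleton_append, hW], h⟩
  · rintro ⟨X, y, Z, hL, h⟩
    exact ⟨X, y :: Z, by simp [hL], y, List.mem_cons_self, rfl, h⟩

theorem admissible (k : OrderKind) (s : Shape) (hL : Poly L) (hv : Poly v) :
    PolyPred fun x => Admissible k s (L x) (v x) := by
  refine (isWeakOrder hL hv).and ((orderKindAllows k hv).and ?_)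
  cases s with
  | singlePeaked => exact singlePeaked hL hv
  | singlePlateaued => exact singlePlateaued hL hv

theorem valid (k : OrderKind) (s : Shape) : PolyPred fun x => (ofTuple x).Valid k s := by
  have hvoters : PolyPred fun x : List ℕ × Profile × List ℕ × ℕ =>
      ∀ u ∈ x.2.1, 0 < u.1 ∧ Admissible k s x.1 u.2 :=
    .forall_mem (by fun_prop) (.and (.lt (.const 0) (by fun_prop))
      (.admissible k s (by fun_prop) (by fun_prop)))
  exact .and (.pairwise Poly.id.fst (.not (.eq (by fun_prop) (by fun_prop))))
    (.and (.mem (by fun_prop) (by fun_prop)) (.and hvoters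
      (.forall_mem (by fun_prop) (.lt (.const 0) (by fun_prop)))))

end PolyPred

theorem Poly.support (hV : Poly V) (ha : Poly a) (hb : Poly b) :
    Poly fun x => support (V x) (a x) (b x) :=
  .sum (hV.map (.ite_of_polyPred (.prefers (by fun_prop) (by fun_prop) (by fun_prop))
    (by fun_prop) (.const 0)))

theorem Poly.scaledScore (n d : ℕ) (hL : Poly L) (hV : Poly V) (ha : Poly a) :
    Poly fun x => scaledScore n d (L x) (V x) (a x) := by
  have hwin : Poly fun y : α × ℕ => TiedVoting.support (V y.1) (a y.1) y.2 :=
    .support (by fun_prop) (by fun_prop) (by fun_prop)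
  have hlose : Poly fun y : α × ℕ => TiedVoting.support (V y.1) y.2 (a y.1) :=
    .support (by fun_prop) (by fun_prop) (by fun_prop)
  have hrivals : Poly fun x => (L x).dedup.filter (· ≠ a x) :=
    hL.dedup.filter (h := fun x b => decide (b ≠ a x))
      (PolyPred.not (.eq (by fun_prop) (by fun_prop))).decide
  exact .sum (hrivals.map (.ite_of_polyPred (.lt hlose hwin) (.const d)
    (.ite_of_polyPred (.eq hwin hlose) (.const n) (.const 0))))

theorem PolyPred.isCopelandWinner {n d : ℕ} (hd : 0 < d) (hL : Poly L) (hV : Poly V)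
    (ha : Poly a) : PolyPred fun x => IsCopelandWinner (n / d) (L x).toFinset (V x) (a x) := by
  have hscore : PolyPred fun y : α × ℕ =>
      scaledScore n d (L y.1) (V y.1) (a y.1) < scaledScore n d (L y.1) (V y.1) y.2 :=
    .lt (.scaledScore n d (by fun_prop) (by fun_prop) (by fun_prop))
      (.scaledScore n d (by fun_prop) (by fun_prop) (by fun_prop))
  exact (PolyPred.and (.mem ha hL) (.forall_mem hL hscore.not)).congr fun x =>
    (isCopelandWinner_iff_scaledScore_le hd).symm

theorem polyPred_mem_copelandCWCM {n d : ℕ} (hd : 0 < d) (hnd : n ≤ d) (k : OrderKind)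
    (s : Shape) : PolyPred fun w => w ∈ copelandCWCM (n / d) k s := by
  have hwinner {B : List ℕ × Profile × List ℕ × ℕ → List ℕ} (hB : Poly B) :
      PolyPred fun x => IsCopelandWinner (n / d) x.1.toFinset
        (x.2.1 ++ TiedVoting.unanimous x.2.2.1 (TiedVoting.ballot (B x) x.2.2.2)) x.2.2.2 :=
    .isCopelandWinner hd (by fun_prop) (.append (by fun_prop)
      (.unanimous (by fun_prop) (.ballot hB (by fun_prop)))) (by fun_prop)
  have hinstance : PolyPred fun x => (ofTuple x).Valid k s ∧
      (ofTuple x).Manipulable (n / d) k s :=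
    ((PolyPred.valid k s).and ((hwinner (by fun_prop)).or
      (hwinner (B := fun x => x.1.reverse) (by fun_prop)))).congr fun x =>
        and_congr_right fun hx => (manipulable_iff (by positivity)
          (div_le_one_of_le₀ (Nat.cast_le.2 hnd) d.cast_nonneg) hx).symm
  have hparse := poly_parseInstance.fst
  refine (PolyPred.and (.eq (poly_encode.comp hparse) .id) (hinstance.comp hparse)).congr
    fun w => ⟨fun ⟨hw, hI⟩ => ⟨_, hw, hI⟩, ?_⟩
  rintro ⟨I, rfl, hI⟩
  rw [parseInstance_encode]
  exact ⟨rfl, hI⟩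

end

end PolyTime

theorem mainTheorem3_general (α : ℚ) (hα₀ : 0 ≤ α) (hα₁ : α ≤ 1) (k : TiedVoting.OrderKind)
    (s : TiedVoting.Shape) : TiedVoting.InP (TiedVoting.copelandCWCM α k s) := by
  lift α to ℚ≥0 using hα₀
  have hα : (α : ℚ) = α.num / α.den := NNRat.cast_def α
  have hnd : α.num ≤ α.den := by
    rwa [hα, div_le_one (Nat.cast_pos.2 α.den_pos), Nat.cast_le] at hα₁
  rw [hα]
  exact (PolyTime.polyPred_mem_copelandCWCM α.den_pos hnd k s).inP

theorem mainTheorem3 (α : ℚ) (hα₀ : 0 ≤ α) (hα₁ : α < 1)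
    (k : TiedVoting.OrderKind) (s : TiedVoting.Shape) :
    TiedVoting.InP (TiedVoting.copelandCWCM α k s) :=
  mainTheorem3_general α hα₀ hα₁.le k s
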